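/- All graphs are finite, simple and undirected, and not necessarily connected. For a vertex $v$ of a graph $G$ let $N[v]$ be its closed neighbourhood, that is, $v$ together with its neighbours. A set $C\subseteq V(G)$ is an identifying code of $G$ if $N[v]\cap C\neq\emptyset$ for every vertex $v$ and $N[u]\cap C\neq N[v]\cap C$ for all distinct vertices $u,v$. The graph $G$ is identifiable if no two distinct vertices have the same closed neighbourhood (equivalently, if $G$ has an identifying code); in that case $\gamma^{\mathrm{ID}}(G)$ denotes the smallest size of an identifying code of $G$. Let $\ell(G)$ be the number of leaves of $G$, that is, of vertices of degree $1$. The girth of $G$ is the length of a shortest cycle, and is $\infty$ if $G$ has no cycle. Theorem. Let $G$ be an identifiable graph of order $n$ with girth at least $5$ and without isolated vertices. Then $$\gamma^{\mathrm{ID}}(G)\le\frac{5n+2\ell(G)}{7}.$$ -/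

import Mathlib

namespace SimpleGraph

/-- The closed neighbourhood `N[v] = N(v) ∪ {v}`. -/
def closedNbhd {V : Type*} (G : SimpleGraph V) (v : V) : Set V :=
  G.neighborSet v ∪ {v}

/-- The `I`-set `I(C; v) = N[v] ∩ C` of a vertex `v` with respect to a code `C`. -/
def iSet {V : Type*} (G : SimpleGraph V) (C : Set V) (v : V) : Set V :=
  G.closedNbhd v ∩ C

/-- `C` is an identifying code: every vertex is covered and any two distinct vertices
are separated. -/
structure IsIdentifyingCode {V : Type*} (G : SimpleGraph V) (C : Set V) : Prop where
  covers : ∀ v : V, (G.iSet C v).Nonempty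
  separates : ∀ u v : V, u ≠ v → G.iSet C u ≠ G.iSet C v

/-- `u` and `v` are closed twins: distinct vertices with the same closed neighbourhood. -/
def IsClosedTwin {V : Type*} (G : SimpleGraph V) (u v : V) : Prop :=
  u ≠ v ∧ G.closedNbhd u = G.closedNbhd v

/-- A graph is identifiable if it has no pair of closed twins. -/
def Identifiable {V : Type*} (G : SimpleGraph V) : Prop :=
  ∀ u v : V, ¬ G.IsClosedTwin u v

/-- The set `L(G)` of leaves, i.e. of vertices of degree one. -/
def leafSet {V : Type*} (G : SimpleGraph V) [G.LocallyFinite] : Set V :=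
  {v : V | G.degree v = 1}

/-- The number `ℓ(G)` of leaves. -/
noncomputable def numLeaves {V : Type*} (G : SimpleGraph V) [G.LocallyFinite] : ℕ :=
  G.leafSet.ncard

/-- `γ^ID(G)`, the smallest size of an identifying code of a finite graph. It is meaningful for
identifiable graphs, see `Identifiable.exists_ncard_eq_idNumber`. -/
noncomputable def idNumber {V : Type*} [Finite V] (G : SimpleGraph V) : ℕ :=
  sInf {k : ℕ | ∃ C : Set V, G.IsIdentifyingCode C ∧ C.ncard = k}

/-- A graph is identifiable if and only if it admits an identifying code. -/
theorem identifiable_iff_exists_isIdentifyingCode {V : Type*} (G : SimpleGraph V) :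
    G.Identifiable ↔ ∃ C : Set V, G.IsIdentifyingCode C := by
  constructor
  · intro h
    refine ⟨Set.univ, ⟨fun v => ⟨v, ?_⟩, fun u v huv he => h u v ⟨huv, ?_⟩⟩⟩
    · simp [iSet, closedNbhd]
    · simpa [iSet] using he
  · rintro ⟨C, hC⟩ u v ⟨huv, he⟩
    exact hC.separates u v huv (by simp [iSet, he])

/-- In an identifiable finite graph the minimum defining `γ^ID(G)` is attained. -/
theorem Identifiable.exists_ncard_eq_idNumber {V : Type*} [Finite V] {G : SimpleGraph V}
    (h : G.Identifiable) : ∃ C : Set V, G.IsIdentifyingCode C ∧ C.ncard = G.idNumber := by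
  obtain ⟨C, hC⟩ := (identifiable_iff_exists_isIdentifyingCode G).1 h
  exact Nat.sInf_mem (s := {k : ℕ | ∃ C : Set V, G.IsIdentifyingCode C ∧ C.ncard = k})
    ⟨C.ncard, C, hC, rfl⟩

end SimpleGraph

/-! ### A separation criterion for girth five, and dominating independent sets in digraphs -/

namespace GirthFive
open SimpleGraph

variable {V : Type*}

/-! It suffices to find a set D whose complement is an identifying code and which satisfies 7|D| ≥
2m, where m is the number of nonleaves. Without triangles and 4-cycles, a vertex of D with two code
neighbours is determined by them, and a code vertex lying in a component of the code with at least
three vertices is separated from all other vertices. So the main requirement is that vertices of D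
with a unique code neighbour have different ones; this is `Setting.isIdentifyingCode`.

D is assembled block by block. The blocks are the paths of a packing by disjoint paths with four to
eight vertices, and the components of the remaining "free" part. The packing maximises first the
total `val` and then the number of covered leaves. Rerouting paths (`IsOptimal.attach`) therefore
restricts where free vertices and ends of paths can be attached. In particular free components are
stars, and when nontrivial they are attached to the packing only at inner vertices of paths with
five to seven vertices, which always stay in the code. Each such star supplies enough vertices of D
(`exists_starCode`).

The rest is accounting, with 7 earned per vertex of D and 2 owed per nonleaf. A path with five to
seven vertices puts its ends into D, and 14 suffices. A path with eight vertices puts three vertices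
into D (`exists_eightCode`), or just its ends if it contains a leaf. A nonleaf isolated in the free
part joins D and marks at most two paths, whose inner vertices are then kept in the code; each mark
costs at most 2, and 2 + 2 + 2 ≤ 7. Only the leafless unmarked paths with four vertices, forming a
family U, fall short: one vertex in D earns 7 against 8.

Two codes are compared; let s be the number of paths with five vertices. The first code is as above;
it lacks at most |U| and gains 4s. For the second, `exists_independent_dominating_half` yields
disjoint F, T ⊆ U with 2(|F| + |T|) ≥ |U|. Paths in F put their two middle vertices into D, paths in
T both ends, which earns 7 more for each. The ends of paths in F now need support elsewhere,
possibly at an end of a path with five vertices, so those paths are left entirely in the code at a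
cost of 10 each. If |U| ≤ 4s the first code suffices; otherwise 7|U|/2 ≥ |U| + 10s and the second
one does. -/

/-- `v` has two neighbours outside `D`. -/
def Two (G : SimpleGraph V) (D : Set V) (v : V) : Prop :=
  ∃ a b, a ≠ b ∧ a ∉ D ∧ b ∉ D ∧ G.Adj v a ∧ G.Adj v b

/-- `v` lies on a path with three vertices, the other two of which are outside `D`. -/
def Big (G : SimpleGraph V) (D : Set V) (v : V) : Prop :=
  ∃ a b, a ∉ D ∧ b ∉ D ∧ b ≠ v ∧ a ≠ b ∧ G.Adj v a ∧ (G.Adj v b ∨ G.Adj a b)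

/-- The facts about a graph `G` with set of leaves `L` on which the construction rests. -/
structure Setting (G : SimpleGraph V) (L : Set V) : Prop where
  no_triangle : ∀ a b c, G.Adj a b → G.Adj b c → ¬ G.Adj a c
  no_square : ∀ a b c d, G.Adj a b → G.Adj b c → G.Adj c d → G.Adj d a → a = c ∨ b = d
  exists_two : ∀ v ∉ L, ∃ a b, a ≠ b ∧ G.Adj v a ∧ G.Adj v b
  leaf : ∀ v ∈ L, ∃ a, G.Adj v a ∧ ∀ b, G.Adj v b → b = a
  no_edge_component : ∀ u v, G.Adj u v → u ∈ L → v ∉ L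

theorem mem_iSet_iff {G : SimpleGraph V} {C : Set V} {u v : V} :
    u ∈ G.iSet C v ↔ (G.Adj v u ∨ u = v) ∧ u ∈ C := by
  simp [iSet, closedNbhd, or_comm]

/-- A criterion for the complement of `D` to be an identifying code. -/
theorem Setting.isIdentifyingCode {G : SimpleGraph V} {L : Set V} (hG : Setting G L) {D : Set V}
    (hD : ∀ d ∈ D, ∃ c ∉ D, G.Adj d c)
    (hpriv : ∀ d ∈ D, ∀ d' ∈ D, ∀ c ∉ D, G.Adj d c → G.Adj d' c → ¬ Two G D d → ¬ Two G D d' →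
      d = d')
    (hC : ∀ c ∉ D, Big G D c ∨ ∀ v, G.Adj c v → v ∈ D ∧ Two G D v) :
    G.IsIdentifyingCode Dᶜ := by
  have key1 : ∀ u v, u ∉ D → v ∉ D → G.iSet Dᶜ u = G.iSet Dᶜ v → u = v := by
    intro u v hu hv he
    by_contra hne
    have h : ∀ c ∉ D, (G.Adj u c ∨ c = u) → (G.Adj v c ∨ c = v) := fun c hc h =>
      (mem_iSet_iff.1 (he ▸ mem_iSet_iff.2 ⟨h, hc⟩)).1
    have h' : ∀ c ∉ D, (G.Adj v c ∨ c = v) → (G.Adj u c ∨ c = u) := fun c hc h =>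
      (mem_iSet_iff.1 (he ▸ mem_iSet_iff.2 ⟨h, hc⟩)).1
    have huv : G.Adj v u := (h u hu (Or.inr rfl)).resolve_right hne
    -- Here u and v are adjacent, so a code neighbour of u other than v would be a common neighbour
    -- and close a triangle; the third code vertex near u gives the contradiction.
    rcases hC u hu with ⟨a, b, ha, hb, hbu, hab, hua, hub⟩ | hl
    · have hav : a = v := (h a ha (Or.inl hua)).resolve_left
        (fun hva => hG.no_triangle v u a huv hua hva)
      subst hav
      rcases hub with hub | hab'
      · exact (h b hb (Or.inl hub)).elim (fun hva => hG.no_triangle a u b huv hub hva)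
          (fun e => hab e.symm)
      · exact (h' b hb (Or.inl hab')).elim (fun hub => hG.no_triangle a u b huv hub hab')
          (fun e => hbu e)
    · exact hv (hl v huv.symm).1
  have key2 : ∀ u v, u ∉ D → v ∈ D → G.iSet Dᶜ u = G.iSet Dᶜ v → False := by
    intro u v hu hv he
    have h : ∀ c ∉ D, (G.Adj u c ∨ c = u) → G.Adj v c := fun c hc h =>
      (mem_iSet_iff.1 (he ▸ mem_iSet_iff.2 ⟨h, hc⟩)).1.resolve_right (fun e => hc (e ▸ hv))
    have h' : ∀ c ∉ D, G.Adj v c → (G.Adj u c ∨ c = u) := fun c hc h =>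
      (mem_iSet_iff.1 (he ▸ mem_iSet_iff.2 ⟨Or.inl h, hc⟩)).1
    have huv : G.Adj v u := h u hu (Or.inr rfl)
    rcases hC u hu with ⟨a, b, ha, hb, hbu, hab, hua, hub⟩ | hl
    · exact hG.no_triangle v u a huv hua (h a ha (Or.inl hua))
    · obtain ⟨a, b, hab, ha, hb, hva, hvb⟩ := (hl v huv.symm).2
      have h1 : a = u := (h' a ha hva).resolve_left (fun hua => hG.no_triangle v u a huv hua hva)
      have h2 : b = u := (h' b hb hvb).resolve_left (fun hua => hG.no_triangle v u b huv hua hvb)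
      exact hab (h1.trans h2.symm)
  have key3 : ∀ u v, u ∈ D → v ∈ D → G.iSet Dᶜ u = G.iSet Dᶜ v → u = v := by
    have aux : ∀ u v, u ∈ D → v ∈ D → G.iSet Dᶜ u = G.iSet Dᶜ v → Two G D u → u = v := by
      rintro u v hu hv he ⟨a, b, hab, ha, hb, hua, hub⟩
      have h : ∀ c ∉ D, G.Adj u c → G.Adj v c := fun c hc h =>
        (mem_iSet_iff.1 (he ▸ mem_iSet_iff.2 ⟨Or.inl h, hc⟩)).1.resolve_right
          (fun e => hc (e ▸ hv))
      exact (hG.no_square u a v b hua (h a ha hua).symm (h b hb hub) hub.symm).resolve_right hab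
    intro u v hu hv he
    by_cases h1 : Two G D u
    · exact aux u v hu hv he h1
    by_cases h2 : Two G D v
    · exact (aux v u hv hu he.symm h2).symm
    obtain ⟨c, hc, huc⟩ := hD u hu
    have hvc : G.Adj v c := (mem_iSet_iff.1 (he ▸ mem_iSet_iff.2 ⟨Or.inl huc, hc⟩)).1.resolve_right
          (fun e => hc (e ▸ hv))
    exact hpriv u hu v hv c hc huc hvc h1 h2
  refine ⟨fun v => ?_, fun u v huv he => ?_⟩
  · by_cases hv : v ∈ D
    · obtain ⟨c, hc, hvc⟩ := hD v hv
      exact ⟨c, mem_iSet_iff.2 ⟨Or.inl hvc, hc⟩⟩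
    · exact ⟨v, mem_iSet_iff.2 ⟨Or.inr rfl, hv⟩⟩
  · by_cases hu : u ∈ D <;> by_cases hv : v ∈ D
    · exact huv (key3 u v hu hv he)
    · exact key2 v u hv hu he.symm
    · exact key2 u v hu hv he
    · exact huv (key1 u v hu hv he)

open Classical in
/-- In every finite digraph some independent set dominates at least half of the vertices. -/
theorem exists_independent_dominating_half {α : Type*} (r : α → α → Prop) (hr : ∀ x, ¬ r x x)
    (S : Finset α) : ∃ F ⊆ S, (∀ x ∈ F, ∀ y ∈ F, ¬ r x y) ∧
      S.card ≤ 2 * (S.filter (fun x => x ∈ F ∨ ∃ y ∈ F, r y x)).card := by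
  induction S using Finset.strongInduction with
  | H S ih =>
    rcases S.eq_empty_or_nonempty with rfl | hS
    · exact ⟨∅, by simp⟩
    have hsum : ∑ v ∈ S, (S.filter (fun x => r x v)).card = ∑ v ∈ S, (S.filter (fun x => r v x)).card :=
      (Finset.sum_card_bipartiteAbove_eq_sum_card_bipartiteBelow r).symm
    -- In-degrees and out-degrees have the same sum, so some v has at least as many out-neighbours
    -- as in-neighbours. Discarding v and both neighbourhoods removes at most 1 + 2|O| vertices, of
    -- which v accounts for 1 + |O| dominated ones.
    obtain ⟨v, hv, hle⟩ := Finset.exists_le_of_sum_le hS hsum.le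
    set I := S.filter (fun x => r x v)
    set O := S.filter (fun x => r v x)
    set S' := S.filter (fun x => x ≠ v ∧ ¬ r x v ∧ ¬ r v x)
    have hS' : S' ⊂ S := Finset.filter_ssubset.2 ⟨v, hv, by simp⟩
    obtain ⟨F, hF, hind, hcard⟩ := ih S' hS'
    have hFS' : ∀ x ∈ F, x ∈ S ∧ x ≠ v ∧ ¬ r x v ∧ ¬ r v x := fun x hx => by
      simpa [S'] using hF hx
    refine ⟨insert v F, ?_, ?_, ?_⟩
    · intro x hx
      rcases Finset.mem_insert.1 hx with rfl | hx
      · exact hv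
      · exact (hFS' x hx).1
    · intro x hx y hy
      rcases Finset.mem_insert.1 hx with hx' | hx' <;> rcases Finset.mem_insert.1 hy with hy' | hy'
      · exact hx' ▸ hy' ▸ hr _
      · exact hx' ▸ (hFS' y hy').2.2.2
      · exact hy' ▸ (hFS' x hx').2.2.1
      · exact hind x hx' y hy'
    · set T := S'.filter (fun x => x ∈ F ∨ ∃ y ∈ F, r y x)
      have h1 : S ⊆ S' ∪ (insert v (I ∪ O)) := by
        intro x hx
        by_cases e : x = v
        · simp [e]
        by_cases h1 : r x v
        · simp [I, hx, h1]
        by_cases h2 : r v x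
        · simp [O, hx, h2]
        · simp [S', hx, e, h1, h2]
      have h2 : T ∪ insert v O ⊆ S.filter (fun x => x ∈ insert v F ∨ ∃ y ∈ insert v F, r y x) := by
        intro x hx
        simp only [Finset.mem_union, Finset.mem_insert, Finset.mem_filter, T, S', O] at hx ⊢
        rcases hx with ⟨⟨hx, -⟩, h | ⟨y, hy, h⟩⟩ | rfl | ⟨hx, h⟩
        · exact ⟨hx, Or.inl (Or.inr h)⟩
        · exact ⟨hx, Or.inr ⟨y, Or.inr hy, h⟩⟩
        · exact ⟨hv, Or.inl (Or.inl rfl)⟩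
        · exact ⟨hx, Or.inr ⟨v, Or.inl rfl, h⟩⟩
      have h3 : Disjoint T (insert v O) := by
        rw [Finset.disjoint_left]
        intro x hx hx'
        simp only [Finset.mem_insert, Finset.mem_filter, T, S', O] at hx hx'
        rcases hx' with rfl | h
        · exact hx.1.2.1 rfl
        · exact hx.1.2.2.2 h.2
      have h4 := Finset.card_le_card h2
      rw [Finset.card_union_of_disjoint h3, Finset.card_insert_of_notMem (by simp [O, hr])] at h4
      have h5 := (Finset.card_le_card h1).trans (Finset.card_union_le _ _)
      have h6 := Finset.card_insert_le v (I ∪ O)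
      have h7 := Finset.card_union_le I O
      omega

end GirthFive

/-! ### Packings of paths and the exchange principle -/

namespace GirthFive
open SimpleGraph

variable {V : Type*}

/-- The list `l` is the list of vertices of a path of `G`. -/
structure IsPathList (G : SimpleGraph V) (l : List V) : Prop where
  nodup : l.Nodup
  chain : l.IsChain G.Adj

theorem IsPathList.reverse {G : SimpleGraph V} {l : List V} (h : IsPathList G l) :
    IsPathList G l.reverse :=
  ⟨List.nodup_reverse.2 h.nodup, by
    rw [List.isChain_reverse]; exact h.chain.imp fun _ _ h => h.symm⟩

theorem IsPathList.left {G : SimpleGraph V} {l₁ l₂ : List V} (h : IsPathList G (l₁ ++ l₂)) :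
    IsPathList G l₁ :=
  ⟨(List.nodup_append.1 h.nodup).1, (List.isChain_append.1 h.chain).1⟩

theorem IsPathList.right {G : SimpleGraph V} {l₁ l₂ : List V} (h : IsPathList G (l₁ ++ l₂)) :
    IsPathList G l₂ :=
  ⟨(List.nodup_append.1 h.nodup).2.1, (List.isChain_append.1 h.chain).2.1⟩

/-- The value of a path with `k` vertices. -/
def val (k : ℕ) : ℕ :=
  if k < 4 then 0 else if k = 4 then 36 else if k = 8 then 73 else if k = 9 then 86 else 10 * k

/-- A family of disjoint paths with four to eight vertices. -/
structure IsPacking (G : SimpleGraph V) (P : Finset (List V)) : Prop where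
  path : ∀ p ∈ P, IsPathList G p
  four_le : ∀ p ∈ P, 4 ≤ p.length
  le_eight : ∀ p ∈ P, p.length ≤ 8
  eq_of_mem : ∀ p ∈ P, ∀ q ∈ P, ∀ v, v ∈ p → v ∈ q → p = q

open Classical in
theorem IsPacking.union {G : SimpleGraph V} {P Q : Finset (List V)} (hP : IsPacking G P)
    (hQ : IsPacking G Q) (h : ∀ p ∈ P, ∀ q ∈ Q, ∀ v, v ∈ p → v ∉ q) :
    IsPacking G (P ∪ Q) ∧ Disjoint P Q := by
  refine ⟨⟨?_, ?_, ?_, ?_⟩, ?_⟩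
  · intro p hp
    exact (Finset.mem_union.1 hp).elim (hP.path p) (hQ.path p)
  · intro p hp
    exact (Finset.mem_union.1 hp).elim (hP.four_le p) (hQ.four_le p)
  · intro p hp
    exact (Finset.mem_union.1 hp).elim (hP.le_eight p) (hQ.le_eight p)
  · intro p hp q hq v hvp hvq
    rcases Finset.mem_union.1 hp with hp | hp <;> rcases Finset.mem_union.1 hq with hq | hq
    · exact hP.eq_of_mem p hp q hq v hvp hvq
    · exact absurd hvq (h p hp q hq v hvp)
    · exact absurd hvp (h q hq p hp v hvq)
    · exact hQ.eq_of_mem p hp q hq v hvp hvq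
  · rw [Finset.disjoint_left]
    intro p hp hq
    -- A common member of both families would have to be empty, which the length bound excludes.
    have := hP.four_le p hp
    obtain ⟨v, hv⟩ := List.exists_mem_of_length_pos (show 0 < p.length by omega)
    exact h p hp p hq v hv hv

theorem IsPacking.singleton {G : SimpleGraph V} {p : List V} (hp : IsPathList G p)
    (h4 : 4 ≤ p.length) (h8 : p.length ≤ 8) : IsPacking G {p} :=
  ⟨by simpa using hp, by simpa using h4, by simpa using h8, by
    intro p hp q hq _ _ _
    rw [Finset.mem_singleton.1 hp, Finset.mem_singleton.1 hq]⟩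

/-- Paths with five to seven vertices are worth 10 per vertex, those with four and eight less, and a
longer path exactly as much as suitable pieces of it. Cutting off five vertices works except for 13
and 14, where the remainder 8 or 9 would be worth too little. -/
theorem exists_add_eq_val {k : ℕ} (hk : 9 ≤ k) :
    ∃ m, 4 ≤ m ∧ m ≤ 8 ∧ m ≤ k ∧ val m + val (k - m) = val k := by
  by_cases h13 : k = 13
  · exact ⟨6, by subst h13; decide⟩
  by_cases h14 : k = 14
  · exact ⟨7, by subst h14; decide⟩
  refine ⟨5, by omega, by omega, by omega, ?_⟩
  unfold val
  split_ifs <;> omega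

open Classical in
/-- A path can be split into a packing of the same value. -/
theorem IsPathList.exists_packing {G : SimpleGraph V} {l : List V} (hl : IsPathList G l) :
    ∃ N : Finset (List V), IsPacking G N ∧ (∀ p ∈ N, ∀ v ∈ p, v ∈ l) ∧
      ∑ p ∈ N, val p.length = val l.length := by
  induction h : l.length using Nat.strong_induction_on generalizing l with
  | _ k ih =>
    by_cases h4 : k < 4
    · exact ⟨∅, ⟨by simp, by simp, by simp, by simp⟩, by simp, by simp [val, h4]⟩
    by_cases h8 : k ≤ 8
    · exact ⟨{l}, IsPacking.singleton hl (by omega) (by omega), by simp, by simp [h]⟩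
    obtain ⟨m, hm4, hm8, hmk, hval⟩ := exists_add_eq_val (show 9 ≤ k by omega)
    have hl' := hl
    rw [← List.take_append_drop m l] at hl'
    obtain ⟨N, hN, hNl, hNv⟩ := ih (k - m) (by omega) hl'.right (by simp [h])
    have hm : (l.take m).length = m := by simp; omega
    have hM := IsPacking.singleton hl'.left (by omega) (by omega)
    have hd : ∀ v ∈ l.take m, v ∉ l.drop m := fun v hv hv' =>
      (List.nodup_append.1 hl'.nodup).2.2 v hv v hv' rfl
    obtain ⟨hu, hdis⟩ := hM.union hN (by
      intro p hp q hq v hvp hvq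
      rw [Finset.mem_singleton.1 hp] at hvp
      exact hd v hvp (hNl q hq v hvq))
    refine ⟨_, hu, ?_, ?_⟩
    · intro p hp v hv
      rcases Finset.mem_union.1 hp with hp | hp
      · rw [Finset.mem_singleton.1 hp] at hv
        exact List.mem_of_mem_take hv
      · exact List.mem_of_mem_drop (hNl p hp v hv)
    · rw [Finset.sum_union hdis, Finset.sum_singleton, hNv, hm, hval]

open Classical in
/-- Number of members of `L` on a list. -/
noncomputable def leafCount (L : Set V) (p : List V) : ℕ := p.countP (fun v => decide (v ∈ L))

theorem leafCount_le (L : Set V) (p : List V) : leafCount L p ≤ p.length := List.countP_le_length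

theorem IsPacking.subset {G : SimpleGraph V} {P Q : Finset (List V)} (hP : IsPacking G P)
    (h : Q ⊆ P) : IsPacking G Q :=
  ⟨fun p hp => hP.path p (h hp), fun p hp => hP.four_le p (h hp),
    fun p hp => hP.le_eight p (h hp), fun p hp q hq => hP.eq_of_mem p (h hp) q (h hq)⟩

section optimal
variable [Fintype V]

/-- The weight of a path: first its value, then the number of its leaves. -/
noncomputable def weight (L : Set V) (p : List V) : ℕ :=
  (Fintype.card V + 1) * val p.length + leafCount L p

theorem IsPacking.sum_length_le {G : SimpleGraph V} {P : Finset (List V)} (hP : IsPacking G P) :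
    ∑ p ∈ P, p.length ≤ Fintype.card V := by
  classical
  have h1 : ∑ p ∈ P, p.length = ∑ p ∈ P, p.toFinset.card :=
    Finset.sum_congr rfl fun p hp => (List.toFinset_card_of_nodup (hP.path p hp).nodup).symm
  rw [h1, ← Finset.card_biUnion]
  · exact Finset.card_le_univ _
  · intro p hp q hq hpq
    rw [Function.onFun, Finset.disjoint_left]
    intro v hv hv'
    exact hpq (hP.eq_of_mem p hp q hq v (List.mem_toFinset.1 hv) (List.mem_toFinset.1 hv'))

/-- A packing of maximum weight. -/
structure IsOptimal (G : SimpleGraph V) (L : Set V) (P : Finset (List V)) : Prop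
    extends IsPacking G P where
  max : ∀ Q, IsPacking G Q → ∑ p ∈ Q, weight L p ≤ ∑ p ∈ P, weight L p

theorem val_le (k : ℕ) : val k ≤ 10 * k := by
  unfold val
  split_ifs <;> omega

theorem exists_isOptimal (G : SimpleGraph V) (L : Set V) : ∃ P, IsOptimal G L P := by
  set s : Set ℕ := {k | ∃ P, IsPacking G P ∧ ∑ p ∈ P, weight L p = k}
  have hne : s.Nonempty := ⟨_, ∅, ⟨by simp, by simp, by simp, by simp⟩, rfl⟩
  have hb : BddAbove s := by
    refine ⟨((Fintype.card V + 1) * 10 + 1) * Fintype.card V, ?_⟩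
    rintro k ⟨P, hP, rfl⟩
    calc ∑ p ∈ P, weight L p ≤ ∑ p ∈ P, ((Fintype.card V + 1) * 10 + 1) * p.length := by
          refine Finset.sum_le_sum fun p _ => ?_
          have h1 := Nat.mul_le_mul_left (Fintype.card V + 1) (val_le p.length)
          have h2 := leafCount_le L p
          unfold weight
          nlinarith
      _ ≤ _ := by
          rw [← Finset.mul_sum]
          exact Nat.mul_le_mul_left _ hP.sum_length_le
  obtain ⟨P, hP, hPs⟩ := Nat.sSup_mem hne hb
  exact ⟨P, hP, fun Q hQ => hPs ▸ le_csSup hb ⟨Q, hQ, rfl⟩⟩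

variable {G : SimpleGraph V} {L : Set V} {P : Finset (List V)}

/-- Replacing some paths of an optimal packing does not increase the weight. -/
theorem IsOptimal.exchange (hP : IsOptimal G L P) {O N : Finset (List V)} (hO : O ⊆ P)
    (hN : IsPacking G N) (h : ∀ p ∈ N, ∀ v ∈ p, ∀ q ∈ P, v ∈ q → q ∈ O) :
    ∑ p ∈ N, weight L p ≤ ∑ p ∈ O, weight L p := by
  classical
  obtain ⟨hu, hd⟩ := (hP.subset (Finset.sdiff_subset (s := P) (t := O))).union hN (by
    intro p hp q hq v hvp hvq
    rw [Finset.mem_sdiff] at hp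
    exact hp.2 (h q hq v hvq p hp.1 hvp))
  have h1 := hP.max _ hu
  rw [Finset.sum_union hd, ← Finset.sum_sdiff hO] at h1
  omega

/-- The factor `Fintype.card V + 1` in `weight` exceeds every possible number of covered leaves, so
the order is lexicographic and the value alone cannot increase. -/
theorem IsOptimal.exchange_val (hP : IsOptimal G L P) {O N : Finset (List V)} (hO : O ⊆ P)
    (hN : IsPacking G N) (h : ∀ p ∈ N, ∀ v ∈ p, ∀ q ∈ P, v ∈ q → q ∈ O) :
    ∑ p ∈ N, val p.length ≤ ∑ p ∈ O, val p.length := by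
  have h1 := hP.exchange hO hN h
  simp only [weight, Finset.sum_add_distrib, ← Finset.mul_sum] at h1
  have h2 : ∑ p ∈ O, leafCount L p ≤ Fintype.card V :=
    (Finset.sum_le_sum fun p _ => leafCount_le L p).trans (hP.subset hO).sum_length_le
  by_contra! h3
  have h4 := Nat.mul_le_mul_left (Fintype.card V + 1) (Nat.succ_le_of_lt h3)
  rw [Nat.mul_succ] at h4
  omega

/-- Replacing some paths of an optimal packing by two other paths. -/
theorem IsOptimal.exchange_two (hP : IsOptimal G L P) {O : Finset (List V)} (hO : O ⊆ P)
    {l l' : List V} (hl : IsPathList G l) (hl' : IsPathList G l') (hd : ∀ v ∈ l, v ∉ l')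
    (h : ∀ v, v ∈ l ∨ v ∈ l' → ∀ q ∈ P, v ∈ q → q ∈ O) :
    val l.length + val l'.length ≤ ∑ p ∈ O, val p.length := by
  classical
  obtain ⟨N, hN, hNl, hNv⟩ := hl.exists_packing
  obtain ⟨N', hN', hNl', hNv'⟩ := hl'.exists_packing
  obtain ⟨hu, hdis⟩ := hN.union hN' (fun p hp q hq v hvp hvq =>
    hd v (hNl p hp v hvp) (hNl' q hq v hvq))
  have := hP.exchange_val hO hu (by
    intro p hp v hv
    rcases Finset.mem_union.1 hp with hp | hp
    · exact h v (Or.inl (hNl p hp v hv))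
    · exact h v (Or.inr (hNl' p hp v hv)))
  rwa [Finset.sum_union hdis, hNv, hNv'] at this

end optimal

end GirthFive

/-! ### Where vertices and ends of paths can be attached to an optimal packing -/

namespace GirthFive
open SimpleGraph

variable {V : Type*}

theorem IsPathList.join {G : SimpleGraph V} {w a : V} {t l : List V}
    (hw : IsPathList G (w :: t)) (ha : IsPathList G (a :: l)) (h : G.Adj w a)
    (hd : ∀ v ∈ w :: t, v ∉ a :: l) : IsPathList G ((w :: t).reverse ++ a :: l) := by
  refine ⟨List.nodup_append.2 ⟨List.nodup_reverse.2 hw.nodup, ha.nodup, ?_⟩,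
    List.isChain_append.2 ⟨hw.reverse.chain, ha.chain, ?_⟩⟩
  · rintro x hx y hy rfl
    exact hd x (List.mem_reverse.1 hx) hy
  · intro x hx y hy
    simp at hx hy
    subst hx hy
    exact h

/-- The vertex `v` lies on no path of the packing. -/
def IsFree (P : Finset (List V)) (v : V) : Prop := ∀ q ∈ P, v ∉ q

variable [Fintype V] {G : SimpleGraph V} {L : Set V} {P : Finset (List V)}

/-- Cut the path just before a and join the part starting at a to the outside path through the edge
wa; the pieces have t.length + l₂.length + 2 and l₁.length vertices. Only a permutation of p is
required, so that a path closing up to a cycle may be rotated. -/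
theorem IsOptimal.attach_aux (hP : IsOptimal G L P) {O : Finset (List V)} (hO : O ⊆ P)
    {p : List V} (hp : p ∈ O) {l₁ l₂ t : List V} {a w : V} (hperm : (l₁ ++ a :: l₂).Perm p)
    (hpath : IsPathList G (l₁ ++ a :: l₂)) (hw : IsPathList G (w :: t))
    (hq : ∀ v ∈ w :: t, v ∉ p ∧ ∀ q ∈ P, v ∈ q → q ∈ O) (h : G.Adj w a) :
    val (t.length + l₂.length + 2) + val l₁.length ≤ ∑ p ∈ O, val p.length := by
  have hmem : ∀ v, v ∈ l₁ ++ a :: l₂ → v ∈ p := fun v => (hperm.mem_iff).1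
  have hl := hw.join hpath.right h (fun v hv hv' =>
    (hq v hv).1 (hmem v (List.mem_append_right _ hv')))
  have hmemO : ∀ v ∈ p, ∀ q ∈ P, v ∈ q → q ∈ O := fun v hv q hqP hvq =>
    hP.eq_of_mem p (hO hp) q hqP v hv hvq ▸ hp
  have := hP.exchange_two hO hl hpath.left (by
      intro v hv hv'
      rcases List.mem_append.1 hv with hv | hv
      · exact (hq v (List.mem_reverse.1 hv)).1 (hmem v (List.mem_append_left _ hv'))
      · exact (List.nodup_append.1 hpath.nodup).2.2 v hv' v hv rfl) (by
      rintro v (hv | hv)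
      · rcases List.mem_append.1 hv with hv | hv
        · exact (hq v (List.mem_reverse.1 hv)).2
        · exact hmemO v (hmem v (List.mem_append_right _ hv))
      · exact hmemO v (hmem v (List.mem_append_left _ hv)))
  simpa [add_assoc, add_comm, add_left_comm] using this

/-- Attaching the end `w` of a path to the vertex `a` of a path of the packing. -/
theorem IsOptimal.attach (hP : IsOptimal G L P) {O : Finset (List V)} (hO : O ⊆ P)
    {p : List V} (hp : p ∈ O) {l₁ l₂ t : List V} {a w : V} (hperm : (l₁ ++ a :: l₂).Perm p)
    (hpath : IsPathList G (l₁ ++ a :: l₂)) (hw : IsPathList G (w :: t))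
    (hq : ∀ v ∈ w :: t, v ∉ p ∧ ∀ q ∈ P, v ∈ q → q ∈ O) (h : G.Adj w a) :
    val (t.length + l₂.length + 2) + val l₁.length ≤ ∑ p ∈ O, val p.length ∧
    val (t.length + l₁.length + 2) + val l₂.length ≤ ∑ p ∈ O, val p.length := by
  refine ⟨hP.attach_aux hO hp hperm hpath hw hq h, ?_⟩
  -- Cutting just after a instead is the same argument on the reversed path.
  have e : (l₁ ++ a :: l₂).reverse = l₂.reverse ++ a :: l₁.reverse := by simp
  have := hP.attach_aux hO hp (l₁ := l₂.reverse) (l₂ := l₁.reverse) (a := a)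
    (e ▸ (List.reverse_perm _).trans hperm) (e ▸ hpath.reverse) hw hq h
  simpa using this

theorem IsOptimal.attach_free (hP : IsOptimal G L P) {p : List V} (hp : p ∈ P)
    {l₁ l₂ t : List V} {a w : V} (hperm : (l₁ ++ a :: l₂).Perm p)
    (hpath : IsPathList G (l₁ ++ a :: l₂)) (hw : IsPathList G (w :: t))
    (hf : ∀ v ∈ w :: t, IsFree P v) (h : G.Adj w a) :
    val (t.length + l₂.length + 2) + val l₁.length ≤ val (l₁.length + l₂.length + 1) ∧
    val (t.length + l₁.length + 2) + val l₂.length ≤ val (l₁.length + l₂.length + 1) := by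
  have e : p.length = l₁.length + l₂.length + 1 := by
    rw [← hperm.length_eq]; simp [add_assoc]
  have := hP.attach (Finset.singleton_subset_iff.2 hp) (Finset.mem_singleton_self p) hperm hpath hw
    (fun v hv => ⟨hf v hv p hp, fun q hq hvq => absurd hvq (hf v hv q hq)⟩) h
  simpa [e] using this

theorem IsOptimal.attach_piece (hP : IsOptimal G L P) {p q : List V} (hp : p ∈ P) (hq : q ∈ P)
    (hne : p ≠ q)
    {l₁ l₂ t : List V} {a w : V} (hperm : (l₁ ++ a :: l₂).Perm p)
    (hpath : IsPathList G (l₁ ++ a :: l₂)) (hpermq : (w :: t).Perm q)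
    (hw : IsPathList G (w :: t)) (h : G.Adj w a) :
    val (t.length + l₂.length + 2) + val l₁.length ≤
      val (l₁.length + l₂.length + 1) + val (t.length + 1) ∧
    val (t.length + l₁.length + 2) + val l₂.length ≤
      val (l₁.length + l₂.length + 1) + val (t.length + 1) := by
  classical
  have e : p.length = l₁.length + l₂.length + 1 := by
    rw [← hperm.length_eq]; simp [add_assoc]
  have e' : q.length = t.length + 1 := by
    rw [← hpermq.length_eq]; simp
  have := hP.attach (O := {p, q}) (by
    intro x hx
    rcases Finset.mem_insert.1 hx with rfl | hx
    · exact hp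
    · exact Finset.mem_singleton.1 hx ▸ hq) (Finset.mem_insert_self _ _) hperm hpath hw
    (fun v hv => by
      have hvq : v ∈ q := hpermq.mem_iff.1 hv
      refine ⟨fun hvp => hne (hP.eq_of_mem p hp q hq v hvp hvq), fun r hr hvr => ?_⟩
      rw [hP.eq_of_mem r hr q hq v hvr hvq]
      simp) h
  rw [Finset.sum_pair hne, e, e'] at this
  exact this

/-- No path of four free vertices. -/
theorem IsOptimal.not_free_path (hP : IsOptimal G L P) {l : List V} (hl : IsPathList G l)
    (hf : ∀ v ∈ l, IsFree P v) : l.length < 4 := by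
  by_contra! h
  obtain ⟨N, hN, hNl, hNv⟩ := hl.exists_packing
  have := hP.exchange_val (Finset.empty_subset P) hN
    (fun p hp v hv q hq hvq => absurd hvq (hf v (hNl p hp v hv) q hq))
  rw [hNv, Finset.sum_empty] at this
  have h0 : 0 < val l.length := by
    unfold val
    split_ifs <;> omega
  omega

/-- The position after `i` and before `j` other vertices is inside a path with five to seven
vertices. -/
def InnerPos (i j : ℕ) : Prop := 1 ≤ i ∧ 1 ≤ j ∧ 4 ≤ i + j ∧ i + j ≤ 6

/-- A finite check of `attach_free` with a tail of one vertex. The position next to an end of a path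
with eight vertices survives because the new path has again eight vertices. -/
theorem IsOptimal.free_attach (hP : IsOptimal G L P) {p : List V} (hp : p ∈ P)
    {l₁ l₂ : List V} {a x : V} (e : p = l₁ ++ a :: l₂) (hx : IsFree P x) (h : G.Adj x a) :
    InnerPos l₁.length l₂.length ∨ (1 ≤ l₁.length ∧ 1 ≤ l₂.length ∧ l₁.length + l₂.length = 3) ∨
      (l₁.length = 1 ∧ l₂.length = 6) ∨ (l₁.length = 6 ∧ l₂.length = 1) := by
  have h4 := hP.four_le p hp
  have h8 := hP.le_eight p hp
  subst e
  have := hP.attach_free hp (List.Perm.refl _) (hP.path _ hp) (t := []) (w := x)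
    ⟨by simp, by simp⟩ (by simpa using hx) h
  simp only [List.length_append, List.length_cons, List.length_nil] at h4 h8 this
  generalize l₁.length = i at *
  generalize l₂.length = j at *
  unfold InnerPos
  have hi : i ≤ 7 := by omega
  have hj : j ≤ 7 := by omega
  interval_cases i <;> interval_cases j <;> first | omega | (simp [val] at this)

theorem IsOptimal.free_edge_attach (hP : IsOptimal G L P) {p : List V} (hp : p ∈ P)
    {l₁ l₂ : List V} {a x y : V} (e : p = l₁ ++ a :: l₂) (hx : IsFree P x) (hy : IsFree P y)
    (hxy : G.Adj x y) (h : G.Adj x a) : InnerPos l₁.length l₂.length := by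
  have h4 := hP.four_le p hp
  have h8 := hP.le_eight p hp
  subst e
  have := hP.attach_free hp (List.Perm.refl _) (hP.path _ hp) (t := [y]) (w := x)
    ⟨by simp [hxy.ne], by simpa using hxy⟩ (by simpa using ⟨hx, hy⟩) h
  simp only [List.length_append, List.length_cons, List.length_nil] at h4 h8 this
  generalize l₁.length = i at *
  generalize l₂.length = j at *
  unfold InnerPos
  have hi : i ≤ 7 := by omega
  have hj : j ≤ 7 := by omega
  interval_cases i <;> interval_cases j <;> first | omega | (simp [val] at this)

/-- A finite check of `attach_piece`. An end of a path with five vertices cannot be excluded, since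
86 = 50 + 36; this is why such paths are emptied in the second code. On a path with eight vertices
only the two middle positions remain. -/
theorem IsOptimal.four_attach (hP : IsOptimal G L P) {p q : List V} (hp : p ∈ P) (hq : q ∈ P)
    (hne : p ≠ q) {l₁ l₂ t : List V} {a w : V} (hperm : (l₁ ++ a :: l₂).Perm p)
    (hpath : IsPathList G (l₁ ++ a :: l₂)) (hpermq : (w :: t).Perm q) (hw : IsPathList G (w :: t)) (h3 : t.length = 3)
    (h : G.Adj w a) :
    InnerPos l₁.length l₂.length ∨ (1 ≤ l₁.length ∧ 1 ≤ l₂.length ∧ l₁.length + l₂.length = 3) ∨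
      (l₁.length = 0 ∧ l₂.length = 4) ∨ (l₁.length = 4 ∧ l₂.length = 0) ∨
      (l₁.length = 3 ∧ l₂.length = 4) ∨ (l₁.length = 4 ∧ l₂.length = 3) := by
  have h4 := hP.four_le p hp
  have h8 := hP.le_eight p hp
  have := hP.attach_piece hp hq hne hperm hpath hpermq hw h
  rw [← hperm.length_eq] at h4 h8
  simp only [List.length_append, List.length_cons, h3] at h4 h8 this
  generalize l₁.length = i at *
  generalize l₂.length = j at *
  unfold InnerPos
  have hi : i ≤ 7 := by omega
  have hj : j ≤ 7 := by omega
  interval_cases i <;> interval_cases j <;> first | omega | (simp [val] at this)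

/-- Appending a free vertex would give five or nine vertices, and 50 > 36, 86 > 73. -/
theorem IsOptimal.four_not_free (hP : IsOptimal G L P) {q : List V} (hq : q ∈ P)
    {t : List V} {x w : V} (hpermq : (w :: t).Perm q) (hw : IsPathList G (w :: t))
    (h3 : t.length = 3 ∨ t.length = 7) (h : G.Adj w x) : ¬ IsFree P x := by
  intro hx
  have := hP.attach_free hq (l₁ := []) (a := w) hpermq hw (t := []) (w := x)
    ⟨by simp, by simp⟩ (by simpa using hx) h.symm
  rcases h3 with h3 | h3 <;> simp [h3, val] at this

theorem IsOptimal.eight_attach (hP : IsOptimal G L P) {p q : List V} (hp : p ∈ P) (hq : q ∈ P)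
    (hne : p ≠ q) {l₁ l₂ t : List V} {a w : V} (e : p = l₁ ++ a :: l₂)
    (hpermq : (w :: t).Perm q) (hw : IsPathList G (w :: t)) (h7 : t.length = 7)
    (h : G.Adj w a) : InnerPos l₁.length l₂.length := by
  have h4 := hP.four_le p hp
  have h8 := hP.le_eight p hp
  subst e
  have := hP.attach_piece hp hq hne (List.Perm.refl _) (hP.path _ hp) hpermq hw h
  simp only [List.length_append, List.length_cons, h7] at h4 h8 this
  generalize l₁.length = i at *
  generalize l₂.length = j at *
  unfold InnerPos
  have hi : i ≤ 7 := by omega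
  have hj : j ≤ 7 := by omega
  interval_cases i <;> interval_cases j <;> first | omega | (simp [val] at this)

/-- Replacing a path of an optimal packing by another one of the same length does not increase the
number of leaves. -/
theorem IsOptimal.leafCount_le (hP : IsOptimal G L P) {p p' : List V} (hp : p ∈ P)
    (hp' : IsPathList G p') (hlen : p'.length = p.length)
    (h : ∀ v ∈ p', v ∈ p ∨ IsFree P v) : leafCount L p' ≤ leafCount L p := by
  have := hP.exchange (Finset.singleton_subset_iff.2 hp)
    (IsPacking.singleton hp' (hlen ▸ hP.four_le p hp) (hlen ▸ hP.le_eight p hp)) (by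
      intro r hr v hv q hq hvq
      rw [Finset.mem_singleton.1 hr] at hv
      rcases h v hv with h | h
      · exact Finset.mem_singleton.2 (hP.eq_of_mem q hq p hp v hvq h)
      · exact absurd hvq (h q hq))
  simpa [weight, hlen] using this

end GirthFive

/-! ### Local codes inside blocks and their assembly -/

namespace GirthFive
open SimpleGraph

variable {V : Type*}

/-- Within `K` and outside `D`, or with the help of a neighbour of a vertex in `H`, the vertex `d`
has two neighbours. -/
def Dbl (G : SimpleGraph V) (K D H : Set V) (d : V) : Prop :=
  (∃ a b, a ≠ b ∧ a ∈ K ∧ a ∉ D ∧ b ∈ K ∧ b ∉ D ∧ G.Adj d a ∧ G.Adj d b) ∨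
    (d ∈ H ∧ ∃ a, a ∈ K ∧ a ∉ D ∧ G.Adj d a)

/-- `D` is a good complement of a code inside the block `K`, provided that the members of `H`
are attached to the code outside `K`. -/
structure LocalCode (G : SimpleGraph V) (K D H : Set V) : Prop where
  dom : ∀ d ∈ D, ∃ c ∈ K, c ∉ D ∧ G.Adj d c
  priv : ∀ d ∈ D, ∀ d' ∈ D, ∀ c ∈ K, c ∉ D → G.Adj d c → G.Adj d' c → d ≠ d' →
    Dbl G K D H d ∨ Dbl G K D H d'
  big : ∀ c ∈ K, c ∉ D → c ∈ H ∨ (∃ a ∈ K, a ∉ D ∧ G.Adj c a ∧ a ∈ H) ∨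
    (∃ a b, a ∈ K ∧ b ∈ K ∧ a ∉ D ∧ b ∉ D ∧ b ≠ c ∧ a ≠ b ∧ G.Adj c a ∧
      (G.Adj c b ∨ G.Adj a b)) ∨
    (∀ v, G.Adj c v → v ∈ D ∧ Dbl G K D H v)

/-- The conditions of the criterion `Setting.isIdentifyingCode` inside the block `K`. -/
structure GoodBlock (G : SimpleGraph V) (D K : Set V) : Prop where
  dom : ∀ d ∈ K, d ∈ D → Two G D d ∨ ∃ c ∈ K, c ∉ D ∧ G.Adj d c
  priv : ∀ d ∈ K, d ∈ D → ∀ d' ∈ K, d' ∈ D → ∀ c ∈ K, c ∉ D → G.Adj d c → G.Adj d' c →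
    ¬ Two G D d → ¬ Two G D d' → d = d'
  big : ∀ c ∈ K, c ∉ D → Big G D c ∨ ∀ v, G.Adj c v → v ∈ D ∧ Two G D v

/-- A vertex of H starts an edge to a code path ub outside K. For a vertex of D this supplies a
second code neighbour, for a code vertex a code path with three vertices. -/
theorem LocalCode.goodBlock {G : SimpleGraph V} {K D H E : Set V} (h : LocalCode G K D H)
    (hE : ∀ v ∈ K, v ∈ E ↔ v ∈ D) (hDK : D ⊆ K)
    (hH : ∀ v ∈ K, v ∈ H → ∃ u b, u ∉ K ∧ u ∉ E ∧ b ∉ K ∧ b ∉ E ∧ G.Adj v u ∧ G.Adj u b) :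
    GoodBlock G E K := by
  have hn : ∀ v ∈ K, v ∉ D → v ∉ E := fun v hv h => mt (hE v hv).1 h
  have hdbl : ∀ d ∈ K, Dbl G K D H d → Two G E d := by
    rintro d hd (⟨a, b, hab, ha, haD, hb, hbD, hda, hdb⟩ | ⟨hdH, a, ha, haD, hda⟩)
    · exact ⟨a, b, hab, hn a ha haD, hn b hb hbD, hda, hdb⟩
    · obtain ⟨u, b, huK, huE, -, -, hdu, -⟩ := hH d hd hdH
      exact ⟨a, u, fun e => huK (e ▸ ha), hn a ha haD, huE, hda, hdu⟩
  refine ⟨?_, ?_, ?_⟩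
  · intro d hd hdE
    obtain ⟨c, hc, hcD, hdc⟩ := h.dom d ((hE d hd).1 hdE)
    exact Or.inr ⟨c, hc, hn c hc hcD, hdc⟩
  · intro d hd hdE d' hd' hdE' c hc hcE hdc hdc' h1 h2
    by_contra hne
    rcases h.priv d ((hE d hd).1 hdE) d' ((hE d' hd').1 hdE') c hc (mt (hE c hc).2 hcE) hdc hdc'
      hne with h' | h'
    · exact h1 (hdbl d hd h')
    · exact h2 (hdbl d' hd' h')
  · intro c hc hcE
    rcases h.big c hc (mt (hE c hc).2 hcE) with hcH | ⟨a, ha, haD, hca, haH⟩ |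
      ⟨a, b, ha, hb, haD, hbD, hbc, hab, hca, hcb⟩ | hl
    · obtain ⟨u, b, huK, huE, hbK, hbE, hcu, hub⟩ := hH c hc hcH
      exact Or.inl ⟨u, b, huE, hbE, fun e => hbK (e ▸ hc), hub.ne, hcu, Or.inr hub⟩
    · obtain ⟨u, b, huK, huE, hbK, hbE, hau, hub⟩ := hH a ha haH
      exact Or.inl ⟨a, u, hn a ha haD, huE, fun e => huK (e ▸ hc), hau.ne, hca, Or.inr hau⟩
    · exact Or.inl ⟨a, b, hn a ha haD, hn b hb hbD, hbc, hab, hca, hcb⟩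
    · refine Or.inr fun v hv => ?_
      obtain ⟨hvD, hv2⟩ := hl v hv
      exact ⟨(hE v (hDK hvD)).2 hvD, hdbl v (hDK hvD) hv2⟩

/-- A vertex of D with only one code neighbour has it in its own block. Hence two such vertices
sharing that neighbour lie in the same block, where `priv` applies, and edges between blocks do no
harm. -/
theorem Setting.isIdentifyingCode_of_goodBlock {G : SimpleGraph V} {L : Set V}
    (hG : Setting G L) {D : Set V} (blk : V → Set V) (hself : ∀ v, v ∈ blk v)
    (hblk : ∀ d c, c ∈ blk d → blk c = blk d) (h : ∀ v, GoodBlock G D (blk v)) :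
    G.IsIdentifyingCode Dᶜ := by
  refine hG.isIdentifyingCode ?_ ?_ ?_
  · intro d hd
    rcases (h d).dom d (hself d) hd with ⟨a, b, -, ha, -, hda, -⟩ | ⟨c, -, hc, hdc⟩
    · exact ⟨a, ha, hda⟩
    · exact ⟨c, hc, hdc⟩
  · intro d hd d' hd' c hc hdc hdc' h1 h2
    have key : ∀ d ∈ D, G.Adj d c → ¬ Two G D d → blk c = blk d := by
      intro d hd hdc h1
      obtain ⟨c', hc'k, hc', hdc'⟩ := ((h d).dom d (hself d) hd).resolve_left h1
      by_cases e : c' = c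
      · exact hblk d c (e ▸ hc'k)
      · exact absurd ⟨c', c, e, hc', hc, hdc', hdc⟩ h1
    exact (h c).priv d (key d hd hdc h1 ▸ hself d) hd d' (key d' hd' hdc' h2 ▸ hself d') hd' c
      (hself c) hc hdc hdc' h1 h2
  · intro c hc
    exact (h c).big c (hself c) hc

/-- A vertex of a path with at least three vertices. -/
theorem IsPathList.exists_path_three {G : SimpleGraph V} {s : List V} (hs : IsPathList G s)
    (h3 : 3 ≤ s.length) {v : V} (hv : v ∈ s) :
    ∃ a b, a ∈ s ∧ b ∈ s ∧ b ≠ v ∧ a ≠ b ∧ G.Adj v a ∧ (G.Adj v b ∨ G.Adj a b) := by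
  obtain ⟨l₁, l₂, rfl⟩ := List.append_of_mem hv
  have aux : ∀ l₁ l₂ : List V, IsPathList G (l₁ ++ v :: l₂) → 2 ≤ l₂.length →
      ∃ a b, a ∈ l₂ ∧ b ∈ l₂ ∧ b ≠ v ∧ a ≠ b ∧ G.Adj v a ∧ (G.Adj v b ∨ G.Adj a b) := by
    rintro l₁ (_ | ⟨a, _ | ⟨b, l⟩⟩) h h2
    · simp at h2
    · simp at h2
    · obtain ⟨hn, hc⟩ := h.right
      simp at hn hc
      exact ⟨a, b, by simp, by simp, fun e => hn.1.2.1 e.symm, hc.2.1.ne, hc.1, Or.inr hc.2.1⟩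
  rcases le_or_gt 2 l₂.length with h2 | h2
  · obtain ⟨a, b, ha, hb, h⟩ := aux _ _ hs h2
    exact ⟨a, b, by simp [ha], by simp [hb], h⟩
  rcases le_or_gt 2 l₁.length with h1 | h1
  · have hr := hs.reverse
    simp only [List.reverse_append, List.reverse_cons, List.append_assoc, List.singleton_append]
      at hr
    obtain ⟨a, b, ha, hb, h⟩ := aux _ _ hr (by simpa using h1)
    exact ⟨a, b, by simp at ha; simp [ha], by simp at hb; simp [hb], h⟩
  rcases l₁ with _ | ⟨a, _ | ⟨_, _⟩⟩ <;> rcases l₂ with _ | ⟨b, _ | ⟨_, _⟩⟩ <;>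
    simp at h1 h2 h3
  obtain ⟨hn, hc⟩ := hs
  simp at hn hc
  exact ⟨a, b, by simp, by simp, fun e => hn.2 e.symm, hn.1.2, hc.1.symm, Or.inl hc.2⟩

/-- A local code in which the vertices of `D` have distinct neighbours in the code. -/
theorem LocalCode.of_hosts {G : SimpleGraph V} {K D H : Set V} (l : List (V × V))
    (hD : ∀ d ∈ D, ∃ c, (d, c) ∈ l) (hl : ∀ x ∈ l, x.2 ∈ K ∧ x.2 ∉ D ∧ G.Adj x.1 x.2)
    (hnodup : (l.map Prod.snd).Nodup)
    (big : ∀ c ∈ K, c ∉ D → c ∈ H ∨ (∃ a ∈ K, a ∉ D ∧ G.Adj c a ∧ a ∈ H) ∨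
      (∃ s, c ∈ s ∧ IsPathList G s ∧ 3 ≤ s.length ∧ ∀ v ∈ s, v ∈ K ∧ v ∉ D) ∨
      (∀ v, G.Adj c v → v ∈ D ∧ Dbl G K D H v)) :
    LocalCode G K D H := by
  refine ⟨?_, ?_, ?_⟩
  · intro d hd
    obtain ⟨c, hc⟩ := hD d hd
    exact ⟨c, hl _ hc⟩
  · intro d hd d' hd' c hc hcD hdc hdc' hne
    obtain ⟨e, he⟩ := hD d hd
    obtain ⟨e', he'⟩ := hD d' hd'
    -- Distinct vertices of D have distinct hosts, so a common code neighbour c is not the host of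
    -- one of them, which therefore has two code neighbours.
    by_cases h1 : e = c
    · by_cases h2 : e' = c
      · have := List.inj_on_of_nodup_map hnodup he he' (h1.trans h2.symm)
        exact absurd (congrArg Prod.fst this) hne
      · exact Or.inr (Or.inl ⟨e', c, h2, (hl _ he').1, (hl _ he').2.1, hc, hcD, (hl _ he').2.2,
          hdc'⟩)
    · exact Or.inl (Or.inl ⟨e, c, h1, (hl _ he).1, (hl _ he).2.1, hc, hcD, (hl _ he).2.2, hdc⟩)
  · intro c hc hcD
    rcases big c hc hcD with h | h | ⟨s, hcs, hs, h3, hsK⟩ | h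
    · exact Or.inl h
    · exact Or.inr (Or.inl h)
    · obtain ⟨a, b, ha, hb, h⟩ := hs.exists_path_three h3 hcs
      exact Or.inr (Or.inr (Or.inl ⟨a, b, (hsK a ha).1, (hsK b hb).1, (hsK a ha).2, (hsK b hb).2,
        h⟩))
    · exact Or.inr (Or.inr (Or.inr h))

/-- The set of end vertices of a list. -/
def ends (p : List V) : Set V := {v | p.head? = some v ∨ p.getLast? = some v}

theorem not_mem_ends {l₁ l₂ : List V} {a : V} (hn : (l₁ ++ a :: l₂).Nodup) (h₁ : l₁ ≠ [])
    (h₂ : l₂ ≠ []) : a ∉ ends (l₁ ++ a :: l₂) := by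
  obtain ⟨x, l₁, rfl⟩ := List.exists_cons_of_ne_nil h₁
  obtain ⟨l₂, y, rfl⟩ := (List.eq_nil_or_concat l₂).resolve_left h₂
  rintro (h | h)
  · simp at h hn
    exact hn.1.2.1 h
  · have e : x :: l₁ ++ a :: (l₂ ++ [y]) = (x :: l₁ ++ a :: l₂) ++ [y] := by simp
    rw [List.concat_eq_append, e, List.getLast?_concat] at h
    rw [List.concat_eq_append, e] at hn
    exact (List.nodup_append.1 hn).2.2 a (by simp) y (by simp) (Option.some.inj h).symm

theorem exists_eq_of_five_le {p : List V} (h : 5 ≤ p.length) :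
    ∃ a b m y z, p = a :: b :: (m ++ [y, z]) ∧ 1 ≤ m.length := by
  rcases p with _ | ⟨a, _ | ⟨b, p⟩⟩
  · simp at h
  · simp at h
  have h1 : p ≠ [] := by rintro rfl; simp at h
  obtain ⟨p, z, rfl⟩ := (List.eq_nil_or_concat p).resolve_left h1
  have h1 : p ≠ [] := by rintro rfl; simp at h
  obtain ⟨p, y, rfl⟩ := (List.eq_nil_or_concat p).resolve_left h1
  exact ⟨a, b, p, y, z, by simp, by simp at h; omega⟩

theorem ends_eq (a b y z : V) (m : List V) : ends (a :: b :: (m ++ [y, z])) = {a, z} := by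
  have e : a :: b :: (m ++ [y, z]) = (a :: b :: (m ++ [y])) ++ [z] := by simp
  ext v
  rw [ends, Set.mem_ofPred_eq, e, List.getLast?_concat]
  simp [eq_comm]

/-- The two ends of a path with at least five vertices. -/
theorem localCode_ends {G : SimpleGraph V} {p : List V} (hp : IsPathList G p)
    (h5 : 5 ≤ p.length) (H : Set V) : LocalCode G {v | v ∈ p} (ends p) H := by
  obtain ⟨a, b, m, y, z, rfl, hm⟩ := exists_eq_of_five_le h5
  have hs : IsPathList G (b :: (m ++ [y])) := by
    have e : a :: b :: (m ++ [y, z]) = [a] ++ ((b :: (m ++ [y])) ++ [z]) := by simp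
    rw [e] at hp
    exact hp.right.left
  have hyz : G.Adj y z := by
    have e : a :: b :: (m ++ [y, z]) = (a :: b :: m) ++ [y, z] := by simp
    rw [e] at hp
    simpa using hp.right.chain
  have hab : G.Adj a b := (List.isChain_cons_cons.1 hp.chain).1
  have hn := hp.nodup
  simp only [List.nodup_cons, List.nodup_append, List.mem_cons, List.mem_append] at hn
  rw [ends_eq]
  have hne : ∀ v ∈ b :: (m ++ [y]), v ≠ a ∧ v ≠ z := by
    intro v hv
    simp only [List.mem_cons, List.mem_append, List.not_mem_nil, or_false] at hv hn
    grind
  refine LocalCode.of_hosts [(a, b), (z, y)] ?_ ?_ ?_ ?_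
  · rintro d (rfl | rfl)
    · exact ⟨b, by simp⟩
    · exact ⟨y, by simp⟩
  · have h1 := hne b (by simp)
    have h2 := hne y (by simp)
    simp [h1, h2, hab, hyz.symm]
  · have := hs.nodup
    simp at this ⊢
    grind
  · intro c hc hcD
    refine Or.inr (Or.inr (Or.inl ⟨_, ?_, hs, by simp; omega, fun v hv => ⟨?_, by simpa using hne v hv⟩⟩))
    · simp at hc hcD ⊢
      tauto
    · simp at hv ⊢
      tauto

/-- The empty set inside a path with at least three vertices. -/
theorem localCode_empty {G : SimpleGraph V} {p : List V} (hp : IsPathList G p)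
    (h3 : 3 ≤ p.length) (H : Set V) : LocalCode G {v | v ∈ p} ∅ H :=
  LocalCode.of_hosts [] (by simp) (by simp) (by simp)
    fun _ hc _ => Or.inr (Or.inr (Or.inl ⟨p, hc, hp, h3, by simp⟩))

theorem localCode_last {G : SimpleGraph V} {a b c d : V} (hp : IsPathList G [a, b, c, d])
    (H : Set V) : LocalCode G {v | v ∈ [a, b, c, d]} {d} H := by
  have hn := hp.nodup
  have hc := hp.chain
  simp at hn hc
  refine LocalCode.of_hosts [(d, c)] (by simp) (by simp [hc.2.2.symm]; grind) (by simp) ?_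
  intro x hx hxd
  refine Or.inr (Or.inr (Or.inl ⟨[a, b, c], ?_, (show IsPathList G ([a, b, c] ++ [d]) from hp).left,
    by simp, by simp; grind⟩))
  simp at hx hxd ⊢
  tauto

/-- Each middle vertex is hosted by the adjacent end. The ends lose their neighbours on the path, so
they depend on code vertices outside it. -/
theorem localCode_middle {G : SimpleGraph V} {a b c d : V} (hp : IsPathList G [a, b, c, d])
    {H : Set V} (ha : a ∈ H) (hd : d ∈ H) : LocalCode G {v | v ∈ [a, b, c, d]} {b, c} H := by
  have hn := hp.nodup
  have hc := hp.chain
  simp at hn hc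
  refine LocalCode.of_hosts [(b, a), (c, d)] (by simp) (by simp [hc, hc.1.symm]; grind)
    (by simp; grind) ?_
  intro x hx hxd
  simp at hx hxd
  grind

end GirthFive

/-! ### Paths with eight vertices: three vertices outside the code -/

namespace GirthFive
open SimpleGraph

variable {V : Type*} {G : SimpleGraph V} {L : Set V}

theorem IsPathList.rotate {l₁ l₂ : List V} (h : IsPathList G (l₁ ++ l₂))
    (hadj : ∀ x ∈ l₂.getLast?, ∀ y ∈ l₁.head?, G.Adj x y) : IsPathList G (l₂ ++ l₁) :=
  ⟨List.perm_append_comm.nodup_iff.1 h.nodup,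
    List.isChain_append.2 ⟨h.right.chain, h.left.chain, hadj⟩⟩

/-- The properties of the local code of a path with eight vertices; `W` is a set of vertices which
may be attached to that path. -/
def IsEightCode (G : SimpleGraph V) (p : List V) (H W : Set V) (D : Finset V) : Prop :=
  (∀ v ∈ D, v ∈ p) ∧ D.card = 3 ∧ LocalCode G {v | v ∈ p} D H ∧
    ∀ w ∈ W, ∀ a ∈ p, G.Adj w a → a ∉ D ∧ ∃ b ∈ p, b ∉ D ∧ G.Adj a b

theorem IsEightCode.congr {p q : List V} {H W : Set V} {D : Finset V}
    (h : IsEightCode G p H W D) (hpq : ∀ v, v ∈ p ↔ v ∈ q) : IsEightCode G q H W D := by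
  have e : {v | v ∈ p} = {v | v ∈ q} := Set.ext hpq
  unfold IsEightCode at *
  rw [e] at h
  simpa only [hpq] using h

/-- D is {v₂, v₃, v₈} if v₁ is supported from outside, and {v₁, v₂, v₈} if a chord gives v₁ a host
v₅ or v₆. In both cases v₄, …, v₇ stay in the code and support whatever W attaches at v₄ or v₅. -/
theorem exists_eightCode_aux {v₁ v₂ v₃ v₄ v₅ v₆ v₇ v₈ : V} {H W : Set V}
    (hp : IsPathList G [v₁, v₂, v₃, v₄, v₅, v₆, v₇, v₈])
    (hW : ∀ w ∈ W, ∀ a ∈ [v₁, v₂, v₃, v₄, v₅, v₆, v₇, v₈], G.Adj w a → a = v₄ ∨ a = v₅)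
    (h : v₁ ∈ H ∨ G.Adj v₁ v₅ ∨ G.Adj v₁ v₆) :
    ∃ D, IsEightCode G [v₁, v₂, v₃, v₄, v₅, v₆, v₇, v₈] H W D := by
  classical
  have hn := hp.nodup
  have hn' := hp.reverse.nodup
  have hc := hp.chain
  simp only [List.nodup_cons, List.mem_cons, List.not_mem_nil, or_false, not_or, not_false_eq_true,
    List.nodup_nil, and_true, List.reverse_cons, List.reverse_nil, List.nil_append,
    List.cons_append] at hn hn'
  simp only [List.isChain_cons_cons, List.isChain_singleton, and_true] at hc
  obtain ⟨h12, h23, h34, h45, h56, h67, h78⟩ := hc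
  by_cases h1 : v₁ ∈ H
  · refine ⟨{v₂, v₃, v₈}, by simp, by simp [hn],
      LocalCode.of_hosts [(v₂, v₁), (v₃, v₄), (v₈, v₇)] ?_ ?_ ?_ ?_, ?_⟩
    · intro d hd
      simp only [Finset.coe_insert, Finset.coe_singleton, Set.mem_insert_iff, Set.mem_singleton_iff] at hd
      rcases hd with rfl | rfl | rfl
      · exact ⟨v₁, by simp⟩
      · exact ⟨v₄, by simp⟩
      · exact ⟨v₇, by simp⟩
    · simp [h12.symm, h34, h78.symm, hn, hn']
    · simp [hn]
    · intro c hc hcD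
      by_cases e : c = v₁
      · exact Or.inl (e ▸ h1)
      · refine Or.inr (Or.inr (Or.inl ⟨[v₄, v₅, v₆, v₇], ?_,
          (show IsPathList G (([v₁, v₂, v₃] ++ [v₄, v₅, v₆, v₇]) ++ [v₈]) from hp).left.right,
          by simp, ?_⟩))
        · replace hc : c ∈ [v₁, v₂, v₃, v₄, v₅, v₆, v₇, v₈] := hc
          simp only [List.mem_cons, List.not_mem_nil, or_false] at hc
          rcases hc with rfl | rfl | rfl | rfl | rfl | rfl | rfl | rfl <;> simp at hcD e ⊢
        · simp [hn, hn']
    · intro w hw a ha hwa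
      rcases hW w hw a ha hwa with rfl | rfl
      · exact ⟨by simp [hn, hn'], v₅, by simp, by simp [hn, hn'], h45⟩
      · exact ⟨by simp [hn, hn'], v₄, by simp, by simp [hn, hn'], h45.symm⟩
  · obtain ⟨x, hx, h1x⟩ : ∃ x, (x = v₅ ∨ x = v₆) ∧ G.Adj v₁ x := by
      rcases h with h | h | h
      · exact absurd h h1
      · exact ⟨_, Or.inl rfl, h⟩
      · exact ⟨_, Or.inr rfl, h⟩
    refine ⟨{v₁, v₂, v₈}, by simp, by simp [hn],
      LocalCode.of_hosts [(v₁, x), (v₂, v₃), (v₈, v₇)] ?_ ?_ ?_ ?_, ?_⟩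
    · intro d hd
      simp only [Finset.coe_insert, Finset.coe_singleton, Set.mem_insert_iff, Set.mem_singleton_iff] at hd
      rcases hd with rfl | rfl | rfl
      · exact ⟨x, by simp⟩
      · exact ⟨v₃, by simp⟩
      · exact ⟨v₇, by simp⟩
    · rcases hx with rfl | rfl <;> simp [h1x, h23, h78.symm, hn, hn']
    · rcases hx with rfl | rfl <;> simp [hn, hn']
    · intro c hc hcD
      refine Or.inr (Or.inr (Or.inl ⟨[v₃, v₄, v₅, v₆, v₇], ?_,
        (show IsPathList G (([v₁, v₂] ++ [v₃, v₄, v₅, v₆, v₇]) ++ [v₈]) from hp).left.right,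
        by simp, ?_⟩))
      · replace hc : c ∈ [v₁, v₂, v₃, v₄, v₅, v₆, v₇, v₈] := hc
        simp only [List.mem_cons, List.not_mem_nil, or_false] at hc
        rcases hc with rfl | rfl | rfl | rfl | rfl | rfl | rfl | rfl <;> simp at hcD ⊢
      · simp [hn, hn']
    · intro w hw a ha hwa
      rcases hW w hw a ha hwa with rfl | rfl
      · exact ⟨by simp [hn, hn'], v₅, by simp, by simp [hn, hn'], h45⟩
      · exact ⟨by simp [hn, hn'], v₄, by simp, by simp [hn, hn'], h45.symm⟩

/-- With D = {v₁, v₃, v₅} all three have two code neighbours on the cycle, and v₆v₇v₈ is a code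
path. By girth the only possible code neighbour of v₂ is v₆, and that of v₄ is v₈: each of the two
either joins the path by such a chord or has all its neighbours in D. -/
theorem exists_eightCode_cycle (hG : Setting G L) {v₁ v₂ v₃ v₄ v₅ v₆ v₇ v₈ : V} {H W : Set V}
    (hp : IsPathList G [v₁, v₂, v₃, v₄, v₅, v₆, v₇, v₈]) (h81 : G.Adj v₈ v₁)
    (hW : ∀ w ∈ W, ∀ a ∈ [v₁, v₂, v₃, v₄, v₅, v₆, v₇, v₈], ¬ G.Adj w a)
    (hout : ∀ v ∈ [v₁, v₂, v₃, v₄, v₅, v₆, v₇, v₈], ∀ u, G.Adj v u →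
      u ∈ [v₁, v₂, v₃, v₄, v₅, v₆, v₇, v₈]) :
    ∃ D, IsEightCode G [v₁, v₂, v₃, v₄, v₅, v₆, v₇, v₈] H W D := by
  classical
  have hn := hp.nodup
  have hn' := hp.reverse.nodup
  have hc := hp.chain
  simp only [List.nodup_cons, List.mem_cons, List.not_mem_nil, or_false, not_or, not_false_eq_true,
    List.nodup_nil, and_true, List.reverse_cons, List.reverse_nil, List.nil_append,
    List.cons_append] at hn hn'
  simp only [List.isChain_cons_cons, List.isChain_singleton, and_true] at hc
  obtain ⟨h12, h23, h34, h45, h56, h67, h78⟩ := hc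
  have hd1 : Dbl G {v | v ∈ [v₁, v₂, v₃, v₄, v₅, v₆, v₇, v₈]} (({v₁, v₃, v₅} : Finset V) : Set V)
      H v₁ := Or.inl ⟨v₂, v₈, by simp [hn, hn', h12, h81.symm]⟩
  have hd3 : Dbl G {v | v ∈ [v₁, v₂, v₃, v₄, v₅, v₆, v₇, v₈]} (({v₁, v₃, v₅} : Finset V) : Set V)
      H v₃ := Or.inl ⟨v₂, v₄, by simp [hn, hn', h23.symm, h34]⟩
  have hd5 : Dbl G {v | v ∈ [v₁, v₂, v₃, v₄, v₅, v₆, v₇, v₈]} (({v₁, v₃, v₅} : Finset V) : Set V)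
      H v₅ := Or.inl ⟨v₄, v₆, by simp [hn, hn', h45.symm, h56]⟩
  have hs : IsPathList G [v₆, v₇, v₈] :=
    (show IsPathList G ([v₁, v₂, v₃, v₄, v₅] ++ [v₆, v₇, v₈]) from hp).right
  refine ⟨{v₁, v₃, v₅}, by simp, by simp [hn],
    LocalCode.of_hosts [(v₁, v₈), (v₃, v₂), (v₅, v₄)] ?_ ?_ ?_ ?_, ?_⟩
  · intro d hd
    simp only [Finset.coe_insert, Finset.coe_singleton, Set.mem_insert_iff, Set.mem_singleton_iff] at hd
    rcases hd with rfl | rfl | rfl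
    · exact ⟨v₈, by simp⟩
    · exact ⟨v₂, by simp⟩
    · exact ⟨v₄, by simp⟩
  · simp [h81.symm, h23.symm, h45.symm, hn, hn']
  · simp [hn, hn']
  · intro c hc hcD
    refine Or.inr (Or.inr ?_)
    have hc' : c = v₂ ∨ c = v₄ ∨ c ∈ [v₆, v₇, v₈] := by
      simp at hc hcD ⊢; tauto
    rcases hc' with rfl | rfl | hc'
    · by_cases h26 : G.Adj c v₆
      · exact Or.inl ⟨[c, v₆, v₇], by simp, ⟨by simp [hn], by simp [h26, h67]⟩, by simp,
          by simp [hn, hn']⟩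
      · refine Or.inr fun v hv => ?_
        have := hout _ hc v hv
        simp only [List.mem_cons, List.not_mem_nil, or_false] at this
        rcases this with rfl | rfl | rfl | rfl | rfl | rfl | rfl | rfl
        · exact ⟨by simp, hd1⟩
        · exact absurd hv G.irrefl
        · exact ⟨by simp, hd3⟩
        · exact absurd hv (hG.no_triangle _ _ _ h23 h34)
        · exact ⟨by simp, hd5⟩
        · exact absurd hv h26
        · have := hG.no_square _ _ _ _ hv h78 h81 h12
          simp [hn, hn'] at this
        · exact absurd hv (hG.no_triangle _ _ _ h12.symm h81.symm)
    · by_cases h48 : G.Adj c v₈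
      · exact Or.inl ⟨[c, v₈, v₇], by simp, ⟨by simp [hn, hn'], by simp [h48, h78.symm]⟩, by simp,
          by simp [hn, hn']⟩
      · refine Or.inr fun v hv => ?_
        have := hout _ hc v hv
        simp only [List.mem_cons, List.not_mem_nil, or_false] at this
        rcases this with rfl | rfl | rfl | rfl | rfl | rfl | rfl | rfl
        · exact ⟨by simp, hd1⟩
        · exact absurd hv (hG.no_triangle _ _ _ h34.symm h23.symm)
        · exact ⟨by simp, hd3⟩
        · exact absurd hv G.irrefl
        · exact ⟨by simp, hd5⟩
        · exact absurd hv (hG.no_triangle _ _ _ h45 h56)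
        · have := hG.no_square _ _ _ _ h45 h56 h67 hv.symm
          simp [hn] at this
        · exact absurd hv h48
    · exact Or.inl ⟨_, hc', hs, by simp, by simp [hn']⟩
  · intro w hw a ha hwa
    exact absurd hwa (hW w hw a ha)

/-- A path with eight vertices whose ends are attached only to `H` has a local code. -/
theorem exists_eightCode (hG : Setting G L) {p : List V} {H W : Set V} (hp : IsPathList G p)
    (h8 : p.length = 8)
    (hend : ∀ w t, (w :: t).Perm p → IsPathList G (w :: t) → ∀ a ∉ p, G.Adj w a → w ∈ H)
    (hW : ∀ l₁ l₂ a, (l₁ ++ a :: l₂).Perm p → IsPathList G (l₁ ++ a :: l₂) → ∀ w ∈ W, G.Adj w a →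
      l₁.length = 3 ∨ l₁.length = 4)
    (hhead : ∀ v, p.head? = some v → v ∉ L) (hlast : ∀ v, p.getLast? = some v → v ∉ L) :
    ∃ D, IsEightCode G p H W D := by
  have hpos : ∀ u₁ u₂ u₃ u₄ u₅ u₆ u₇ u₈, [u₁, u₂, u₃, u₄, u₅, u₆, u₇, u₈].Perm p →
      IsPathList G [u₁, u₂, u₃, u₄, u₅, u₆, u₇, u₈] →
      ∀ w ∈ W, ∀ a ∈ [u₁, u₂, u₃, u₄, u₅, u₆, u₇, u₈], G.Adj w a → a = u₄ ∨ a = u₅ := by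
    intro u₁ u₂ u₃ u₄ u₅ u₆ u₇ u₈ hperm hpath w hw a ha hwa
    obtain ⟨l₁, l₂, e⟩ := List.append_of_mem ha
    rw [e] at hperm hpath
    rcases hW l₁ l₂ a hperm hpath w hw hwa with h | h
    · obtain ⟨x, y, z, rfl⟩ := List.length_eq_three.1 h
      simp at e
      exact Or.inl e.2.2.2.1.symm
    · rcases l₁ with _ | ⟨_, l₁⟩
      · simp at h
      obtain ⟨x, y, z, rfl⟩ := List.length_eq_three.1 (Nat.succ.inj h)
      simp at e
      exact Or.inr e.2.2.2.2.1.symm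
  have hcode : ∀ u₁ u₂ u₃ u₄ u₅ u₆ u₇ u₈, [u₁, u₂, u₃, u₄, u₅, u₆, u₇, u₈].Perm p →
      IsPathList G [u₁, u₂, u₃, u₄, u₅, u₆, u₇, u₈] → (u₁ ∈ H ∨ G.Adj u₁ u₅ ∨ G.Adj u₁ u₆) →
      ∃ D, IsEightCode G p H W D := by
    intro u₁ u₂ u₃ u₄ u₅ u₆ u₇ u₈ hperm hpath h
    obtain ⟨D, hD⟩ := exists_eightCode_aux hpath (hpos _ _ _ _ _ _ _ _ hperm hpath) h
    exact ⟨D, hD.congr fun v => hperm.mem_iff⟩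
  obtain ⟨v₁, v₂, v₃, v₄, v₅, v₆, v₇, v₈, rfl⟩ :
      ∃ v₁ v₂ v₃ v₄ v₅ v₆ v₇ v₈, p = [v₁, v₂, v₃, v₄, v₅, v₆, v₇, v₈] := by
    rcases p with _ | ⟨v₁, _ | ⟨v₂, _ | ⟨v₃, _ | ⟨v₄, _ | ⟨v₅, _ | ⟨v₆, _ | ⟨v₇, _ | ⟨v₈,
      _ | ⟨_, _⟩⟩⟩⟩⟩⟩⟩⟩⟩ <;> simp at h8
    exact ⟨v₁, v₂, v₃, v₄, v₅, v₆, v₇, v₈, rfl⟩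
  have hn := hp.nodup
  have hc := hp.chain
  simp only [List.nodup_cons, List.mem_cons, List.not_mem_nil, or_false, not_or, not_false_eq_true,
    List.nodup_nil, and_true] at hn
  simp only [List.isChain_cons_cons, List.isChain_singleton, and_true] at hc
  obtain ⟨h12, h23, h34, h45, h56, h67, h78⟩ := hc
  have hprev := hp.reverse
  have hpermrev := List.reverse_perm [v₁, v₂, v₃, v₄, v₅, v₆, v₇, v₈]
  simp only [List.reverse_cons, List.reverse_nil, List.nil_append, List.cons_append] at hprev hpermrev
  have hex : ∀ v ∉ L, ∀ u, ∃ a, a ≠ u ∧ G.Adj v a := by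
    intro v hv u
    obtain ⟨a, b, hab, ha, hb⟩ := hG.exists_two v hv
    by_cases e : a = u
    · exact ⟨b, fun h => hab (e.trans h.symm), hb⟩
    · exact ⟨a, e, ha⟩
  by_cases hA : v₁ ∈ H ∨ G.Adj v₁ v₅ ∨ G.Adj v₁ v₆
  · exact hcode _ _ _ _ _ _ _ _ (List.Perm.refl _) hp hA
  by_cases hB : v₈ ∈ H ∨ G.Adj v₈ v₄ ∨ G.Adj v₈ v₃
  · exact hcode _ _ _ _ _ _ _ _ hpermrev hprev hB
  -- The nonleaf v₁ has a neighbour besides v₂. Girth excludes v₃ and v₄, and outside neighbours, v₅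
  -- and v₆ are already settled.
  have h1 : G.Adj v₁ v₇ ∨ G.Adj v₁ v₈ := by
    obtain ⟨a, ha2, h1a⟩ := hex v₁ (hhead v₁ rfl) v₂
    by_cases hap : a ∈ [v₁, v₂, v₃, v₄, v₅, v₆, v₇, v₈]
    · simp only [List.mem_cons, List.not_mem_nil, or_false] at hap
      rcases hap with rfl | rfl | rfl | rfl | rfl | rfl | rfl | rfl
      · exact absurd h1a G.irrefl
      · exact absurd rfl ha2
      · exact absurd h1a (hG.no_triangle _ _ _ h12 h23)
      · have := hG.no_square _ _ _ _ h12 h23 h34 h1a.symm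
        simp [hn] at this
      · exact absurd (Or.inr (Or.inl h1a)) hA
      · exact absurd (Or.inr (Or.inr h1a)) hA
      · exact Or.inl h1a
      · exact Or.inr h1a
    · exact absurd (Or.inl (hend _ _ (List.Perm.refl _) hp a hap h1a)) hA
  have h8' : G.Adj v₈ v₂ ∨ G.Adj v₈ v₁ := by
    obtain ⟨a, ha2, h1a⟩ := hex v₈ (hlast v₈ rfl) v₇
    by_cases hap : a ∈ [v₁, v₂, v₃, v₄, v₅, v₆, v₇, v₈]
    · simp only [List.mem_cons, List.not_mem_nil, or_false] at hap
      rcases hap with rfl | rfl | rfl | rfl | rfl | rfl | rfl | rfl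
      · exact Or.inr h1a
      · exact Or.inl h1a
      · exact absurd (Or.inr (Or.inr h1a)) hB
      · exact absurd (Or.inr (Or.inl h1a)) hB
      · have := hG.no_square _ _ _ _ h56 h67 h78 h1a
        simp [hn] at this
      · exact absurd h1a.symm (hG.no_triangle _ _ _ h67 h78)
      · exact absurd rfl ha2
      · exact absurd h1a G.irrefl
    · exact absurd (Or.inl (hend _ _ hpermrev hprev a hap h1a)) hB
  -- The alternative, chords v₁v₇ and v₂v₈ together, gives the 4-cycle v₁v₂v₈v₇.
  have h81 : G.Adj v₈ v₁ := by
    rcases h1 with h1 | h1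
    · rcases h8' with h8' | h8'
      · have := hG.no_square _ _ _ _ h12 h8'.symm h78.symm h1.symm
        simp [hn] at this
      · exact h8'
    · exact h1.symm
  have hrot : ∀ l₁ l₂, [v₁, v₂, v₃, v₄, v₅, v₆, v₇, v₈] = l₁ ++ l₂ → IsPathList G (l₂ ++ l₁) := by
    intro l₁ l₂ e
    refine IsPathList.rotate (e ▸ hp) ?_
    intro x hx y hy
    have hx' : [v₁, v₂, v₃, v₄, v₅, v₆, v₇, v₈].getLast? = some x := by
      rw [e]; exact List.mem_getLast?_append_of_mem_getLast? hx
    have hy' : [v₁, v₂, v₃, v₄, v₅, v₆, v₇, v₈].head? = some y := by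
      rw [e]; exact List.mem_head?_append_of_mem_head? hy
    simp at hx' hy'
    exact hx' ▸ hy' ▸ h81
  by_cases hout : ∀ v ∈ [v₁, v₂, v₃, v₄, v₅, v₆, v₇, v₈], ∀ u, G.Adj v u →
      u ∈ [v₁, v₂, v₃, v₄, v₅, v₆, v₇, v₈]
  · refine exists_eightCode_cycle hG hp h81 ?_ hout
    intro w hw a ha hwa
    obtain ⟨l₁, l₂, e⟩ := List.append_of_mem ha
    have hperm : ([] ++ a :: (l₂ ++ l₁)).Perm [v₁, v₂, v₃, v₄, v₅, v₆, v₇, v₈] := by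
      rw [e]; exact List.perm_append_comm (l₁ := a :: l₂)
    -- Rotating the cycle moves a to position 0, where nothing from W can be attached.
    rcases hW [] (l₂ ++ l₁) a hperm (hrot l₁ (a :: l₂) e) w hw hwa with h | h <;> simp at h
  -- A vertex with a neighbour off the cycle becomes the first vertex after rotation, and is then in
  -- H.
  · push Not at hout
    obtain ⟨v, hv, u, hvu, hu⟩ := hout
    obtain ⟨l₁, l₂, e⟩ := List.append_of_mem hv
    have hperm : (v :: (l₂ ++ l₁)).Perm [v₁, v₂, v₃, v₄, v₅, v₆, v₇, v₈] := by
      rw [e]; exact List.perm_append_comm (l₁ := v :: l₂)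
    have hpath : IsPathList G (v :: (l₂ ++ l₁)) := hrot l₁ (v :: l₂) e
    have hvH := hend v (l₂ ++ l₁) hperm hpath u hu hvu
    have hlen : (v :: (l₂ ++ l₁)).length = 8 := hperm.length_eq
    generalize l₂ ++ l₁ = t at hperm hpath hlen
    rcases t with _ | ⟨u₂, _ | ⟨u₃, _ | ⟨u₄, _ | ⟨u₅, _ | ⟨u₆, _ | ⟨u₇, _ | ⟨u₈,
      _ | ⟨_, _⟩⟩⟩⟩⟩⟩⟩⟩ <;> simp at hlen
    exact hcode _ _ _ _ _ _ _ _ hperm hpath (Or.inl hvH)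

end GirthFive

/-! ### Stars -/

namespace GirthFive
open SimpleGraph

variable {V : Type*} {G : SimpleGraph V} {L : Set V}

/-- All of D is hosted by the centre, so of any two members one must have a second code neighbour
through H. The alternatives in `hbig` each ensure that the code near c extends to at least three
vertices. -/
theorem localCode_star_aux {K D : Finset V} {c : V} {H : Set V} (hc : c ∈ K)
    (hstar : ∀ y ∈ K, y ≠ c → G.Adj c y) (hDK : D ⊆ K) (hcD : c ∉ D)
    (hD : ∀ d ∈ D, ∀ d' ∈ D, d ≠ d' → d ∈ H ∨ d' ∈ H)
    (hbig : c ∈ H ∨ (∃ y ∈ K, y ∉ D ∧ y ≠ c ∧ y ∈ H) ∨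
      ∃ y ∈ K, ∃ z ∈ K, y ∉ D ∧ z ∉ D ∧ y ≠ c ∧ z ≠ c ∧ y ≠ z) :
    LocalCode G (K : Set V) (D : Set V) H := by
  have hadj : ∀ d ∈ D, G.Adj d c := fun d hd =>
    (hstar d (hDK hd) (fun e => hcD (e ▸ hd))).symm
  refine ⟨fun d hd => ⟨c, hc, hcD, hadj d hd⟩, ?_, ?_⟩
  · intro d hd d' hd' _ _ _ _ _ hne
    rcases hD d hd d' hd' hne with h | h
    · exact Or.inl (Or.inr ⟨h, c, hc, hcD, hadj d hd⟩)
    · exact Or.inr (Or.inr ⟨h, c, hc, hcD, hadj d' hd'⟩)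
  · intro x hx hxD
    simp only [Finset.mem_coe] at *
    by_cases hxc : x = c
    · subst hxc
      rcases hbig with h | ⟨y, hy, hyD, hyc, hyH⟩ | ⟨y, hy, z, hz, hyD, hzD, hyc, hzc, hyz⟩
      · exact Or.inl h
      · exact Or.inr (Or.inl ⟨y, hy, hyD, hstar y hy hyc, hyH⟩)
      · exact Or.inr (Or.inr (Or.inl ⟨y, z, hy, hz, hyD, hzD, hzc, hyz, hstar y hy hyc,
          Or.inl (hstar z hz hzc)⟩))
    · have hxa := (hstar x hx hxc).symm
      have aux : ∀ y ∈ K, y ∉ D → y ≠ c → y ≠ x →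
          ∃ a b, a ∈ K ∧ b ∈ K ∧ a ∉ D ∧ b ∉ D ∧ b ≠ x ∧ a ≠ b ∧ G.Adj x a ∧
            (G.Adj x b ∨ G.Adj a b) := fun y hy hyD hyc hyx =>
        ⟨c, y, hc, hy, hcD, hyD, hyx, hyc.symm, hxa, Or.inr (hstar y hy hyc)⟩
      rcases hbig with h | ⟨y, hy, hyD, hyc, hyH⟩ | ⟨y, hy, z, hz, hyD, hzD, hyc, hzc, hyz⟩
      · exact Or.inr (Or.inl ⟨c, hc, hcD, hxa, h⟩)
      · by_cases e : y = x
        · exact Or.inl (e ▸ hyH)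
        · exact Or.inr (Or.inr (Or.inl (aux y hy hyD hyc e)))
      · by_cases e : y = x
        · exact Or.inr (Or.inr (Or.inl (aux z hz hzD hzc (fun e' => hyz (e.trans e'.symm)))))
        · exact Or.inr (Or.inr (Or.inl (aux y hy hyD hyc e)))

open Classical in
/-- A star attached to the rest of the graph only through `H` has a local code. -/
theorem exists_starCode (hG : Setting G L) {K : Finset V} {c : V} {H : Set V} (hc : c ∈ K)
    (hstar : ∀ y ∈ K, y ≠ c → G.Adj c y) (hK : 2 ≤ K.card)
    (hclosed : ∀ v ∈ K, ∀ u, G.Adj v u → u ∈ K ∨ v ∈ H) :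
    ∃ D ⊆ K, LocalCode G (K : Set V) (D : Set V) H ∧
      2 * (K.filter (· ∉ L)).card ≤ 7 * D.card := by
  set Y := K.erase c
  set S := Y.filter (· ∉ L)
  have hYcard : Y.card + 1 = K.card := Finset.card_erase_add_one hc
  have hmemY : ∀ y, y ∈ Y ↔ y ≠ c ∧ y ∈ K := fun y => Finset.mem_erase
  -- A nonleaf ray has a second neighbour, which cannot be in the star because there are no
  -- triangles.
  have hYH : ∀ y ∈ Y, y ∉ L → y ∈ H := by
    intro y hy hyL
    obtain ⟨hyc, hyK⟩ := (hmemY y).1 hy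
    obtain ⟨a, b, hab, ha, hb⟩ := hG.exists_two y hyL
    have key : ∀ a, a ≠ c → G.Adj y a → y ∈ H := fun a hac ha =>
      (hclosed y hyK a ha).resolve_left
        (fun haK => hG.no_triangle _ _ _ (hstar y hyK hyc) ha (hstar a haK hac))
    by_cases e : a = c
    · exact key b (fun e' => hab (e.trans e'.symm)) hb
    · exact key a e ha
  have hcount : (K.filter (· ∉ L)).card ≤ S.card + 1 := by
    refine (Finset.card_le_card (t := insert c S) ?_).trans (Finset.card_insert_le _ _)
    intro x hx
    simp only [Finset.mem_filter, Finset.mem_insert, S, Y, Finset.mem_erase] at hx ⊢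
    tauto
  have hSY : ∀ y ∈ S, y ∈ Y ∧ y ∉ L := fun y hy => Finset.mem_filter.1 hy
  by_cases hcH : c ∈ H
  · by_cases hS : S.card = 0
    · obtain ⟨y, hy⟩ : Y.Nonempty := Finset.card_pos.1 (by omega)
      have hy' := (hmemY y).1 hy
      refine ⟨{y}, by simpa using hy'.2, localCode_star_aux hc hstar (by simpa using hy'.2)
        (by simpa using hy'.1.symm) (by simp) (Or.inl hcH), ?_⟩
      simp only [Finset.card_singleton]
      omega
    · refine ⟨S, fun y hy => ((hmemY y).1 (hSY y hy).1).2, localCode_star_aux hc hstar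
        (fun y hy => ((hmemY y).1 (hSY y hy).1).2) (fun h => ((hmemY c).1 (hSY c h).1).1 rfl)
        (fun d hd _ _ _ => Or.inl (hYH d (hSY d hd).1 (hSY d hd).2)) (Or.inl hcH), by omega⟩
  have hcK : ∀ u, G.Adj c u → u ∈ Y := fun u hu =>
    (hmemY u).2 ⟨hu.ne', (hclosed c hc u hu).resolve_right hcH⟩
  by_cases hS : S.Nonempty
  · obtain ⟨y₁, hy₁⟩ := hS
    have hy₁Y := (hSY y₁ hy₁).1
    have hy₁H := hYH y₁ hy₁Y (hSY y₁ hy₁).2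
    have hy₁' := (hmemY y₁).1 hy₁Y
    -- The supported ray y₁ stays in the code for the benefit of c, and another ray y₂ is put into
    -- D. Even if y₂ is already in S, |D| ≥ max(1, |S| − 1), which is enough for at most |S| + 1
    -- nonleaves.
    by_cases hY : ∃ y₂ ∈ Y, y₂ ≠ y₁
    · obtain ⟨y₂, hy₂, hne⟩ := hY
      have hy₂' := (hmemY y₂).1 hy₂
      have hsub : ∀ y ∈ insert y₂ (S.erase y₁), y ∈ K := by
        intro y hy
        rcases Finset.mem_insert.1 hy with rfl | hy
        · exact hy₂'.2
        · exact ((hmemY y).1 (hSY y (Finset.mem_of_mem_erase hy)).1).2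
      refine ⟨insert y₂ (S.erase y₁), hsub, localCode_star_aux hc hstar hsub ?_ ?_
        (Or.inr (Or.inl ⟨y₁, hy₁'.2, by simp [hne.symm], hy₁'.1, hy₁H⟩)), ?_⟩
      · intro h
        rcases Finset.mem_insert.1 h with h | h
        · exact hy₂'.1 h.symm
        · exact ((hmemY c).1 (hSY c (Finset.mem_of_mem_erase h)).1).1 rfl
      · have key : ∀ d ∈ insert y₂ (S.erase y₁), d ≠ y₂ → d ∈ H := by
          intro d hd hne
          have := Finset.mem_of_mem_erase ((Finset.mem_insert.1 hd).resolve_left hne)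
          exact hYH d (hSY d this).1 (hSY d this).2
        intro d hd d' hd' hne'
        by_cases e : d = y₂
        · exact Or.inr (key d' hd' (fun e' => hne' (e.trans e'.symm)))
        · exact Or.inl (key d hd e)
      · have h1 := Finset.card_le_card (Finset.subset_insert y₂ (S.erase y₁))
        have h2 := Finset.card_erase_add_one hy₁
        have h3 : 0 < (insert y₂ (S.erase y₁)).card :=
          Finset.card_pos.2 ⟨y₂, Finset.mem_insert_self _ _⟩
        omega
    · push Not at hY
      have hK' : ∀ x ∈ K, x ≠ c → x = y₁ := fun x hx hxc => hY x ((hmemY x).2 ⟨hxc, hx⟩)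
      have hS1 : S.card ≤ 1 := Finset.card_le_one.2 fun a ha b hb =>
        (hY a (hSY a ha).1).trans (hY b (hSY b hb).1).symm
      refine ⟨{c}, by simpa using hc, ⟨?_, ?_, ?_⟩, by simp only [Finset.card_singleton]; omega⟩
      · intro d hd
        simp only [Finset.coe_singleton, Set.mem_singleton_iff] at hd ⊢
        subst hd
        exact ⟨y₁, hy₁'.2, hy₁'.1, hstar y₁ hy₁'.2 hy₁'.1⟩
      · intro d hd d' hd' _ _ _ _ _ hne
        simp only [Finset.coe_singleton, Set.mem_singleton_iff] at hd hd'
        exact absurd (hd.trans hd'.symm) hne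
      · intro x hx hxc
        simp only [Finset.coe_singleton, Set.mem_singleton_iff] at hxc
        exact Or.inl (hK' x hx hxc ▸ hy₁H)
  · have hleaf : ∀ y ∈ Y, y ∈ L := by
      intro y hy
      by_contra h
      exact hS ⟨y, Finset.mem_filter.2 ⟨hy, h⟩⟩
    have hS0 : S.card = 0 := by rw [Finset.card_eq_zero]; exact Finset.not_nonempty_iff_eq_empty.1 hS
    obtain ⟨y₀, hy₀⟩ : Y.Nonempty := Finset.card_pos.1 (by omega)
    have hy₀' := (hmemY y₀).1 hy₀
    have hcL : c ∉ L := hG.no_edge_component y₀ c (hstar y₀ hy₀'.2 hy₀'.1).symm (hleaf y₀ hy₀)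
    obtain ⟨a, b, hab, hca, hcb⟩ := hG.exists_two c hcL
    have ha := hcK a hca
    have hb := hcK b hcb
    -- Here the star is a whole component with leaves as rays. With three rays one of them goes into
    -- D; with two, the centre does, and the leaves become isolated code vertices whose only
    -- neighbour c has two code neighbours.
    by_cases hY : ∃ d ∈ Y, d ≠ a ∧ d ≠ b
    · obtain ⟨d, hd, hda, hdb⟩ := hY
      have hd' := (hmemY d).1 hd
      refine ⟨{d}, by simpa using hd'.2, localCode_star_aux hc hstar (by simpa using hd'.2)
        (by simpa using hd'.1.symm) (by simp) (Or.inr (Or.inr ⟨a, ((hmemY a).1 ha).2, b,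
          ((hmemY b).1 hb).2, by simpa using hda.symm, by simpa using hdb.symm, hca.ne', hcb.ne',
          hab⟩)), ?_⟩
      simp only [Finset.card_singleton]
      omega
    · push Not at hY
      refine ⟨{c}, by simpa using hc, ⟨?_, ?_, ?_⟩, by simp only [Finset.card_singleton]; omega⟩
      · intro d hd
        simp only [Finset.coe_singleton, Set.mem_singleton_iff] at hd ⊢
        subst hd
        exact ⟨a, ((hmemY a).1 ha).2, hca.ne', hca⟩
      · intro d hd d' hd' _ _ _ _ _ hne
        simp only [Finset.coe_singleton, Set.mem_singleton_iff] at hd hd'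
        exact absurd (hd.trans hd'.symm) hne
      · intro x hx hxc
        simp only [Finset.coe_singleton, Set.mem_singleton_iff] at hxc
        refine Or.inr (Or.inr (Or.inr fun v hv => ?_))
        obtain ⟨u, -, hu⟩ := hG.leaf x (hleaf x ((hmemY x).2 ⟨hxc, hx⟩))
        have hvc : v = c := (hu v hv).trans (hu c (hstar x hx hxc).symm).symm
        subst hvc
        refine ⟨by simp, Or.inl ⟨a, b, hab, ((hmemY a).1 ha).2, ?_, ((hmemY b).1 hb).2, ?_, hca, hcb⟩⟩
        · simpa using hca.ne'
        · simpa using hcb.ne'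

end GirthFive

/-! ### The free part -/

namespace GirthFive
open SimpleGraph

variable {V : Type*} {G : SimpleGraph V} {L : Set V} {P : Finset (List V)}

/-- The vertices inside the paths with five to seven vertices. -/
def inner (P : Finset (List V)) : Set V :=
  {a | ∃ l₁ l₂, l₁ ++ a :: l₂ ∈ P ∧ InnerPos l₁.length l₂.length}

/-- The vertices attached to `inner P`. -/
def hooked (G : SimpleGraph V) (P : Finset (List V)) : Set V := {v | ∃ a ∈ inner P, G.Adj v a}

theorem exists_mem_of_not_isFree {v : V} (hv : ¬ IsFree P v) : ∃ p ∈ P, v ∈ p := by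
  unfold IsFree at hv
  push Not at hv
  exact hv

/-- The vertex `x` is free and has a free neighbour. -/
def IsPaired (G : SimpleGraph V) (P : Finset (List V)) (x : V) : Prop :=
  IsFree P x ∧ ∃ y, IsFree P y ∧ G.Adj x y

variable [Fintype V]

open Classical in
/-- The component of `x` in the graph induced by the free vertices. -/
noncomputable def freeClass (G : SimpleGraph V) (P : Finset (List V)) (x : V) : Finset V :=
  Finset.univ.filter fun y => IsFree P y ∧
    (y = x ∨ G.Adj x y ∨ ∃ c, IsFree P c ∧ G.Adj c x ∧ G.Adj c y)

theorem mem_freeClass {x y : V} : y ∈ freeClass G P x ↔ IsFree P y ∧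
    (y = x ∨ G.Adj x y ∨ ∃ c, IsFree P c ∧ G.Adj c x ∧ G.Adj c y) := by
  simp [freeClass]

theorem mem_freeClass_self {x : V} (hx : IsFree P x) : x ∈ freeClass G P x :=
  mem_freeClass.2 ⟨hx, Or.inl rfl⟩

theorem IsOptimal.no_free_four (hP : IsOptimal G L P) {a b c d : V} (ha : IsFree P a)
    (hb : IsFree P b) (hc : IsFree P c) (hd : IsFree P d) (hab : G.Adj a b) (hbc : G.Adj b c)
    (hcd : G.Adj c d) (hac : a ≠ c) (hbd : b ≠ d) (had : a ≠ d) : False := by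
  have := hP.not_free_path (l := [a, b, c, d])
    ⟨by simp [hab.ne, hbc.ne, hcd.ne, hac, hbd, had], by simp [hab, hbc, hcd]⟩
    (by simp [ha, hb, hc, hd])
  simp at this

theorem mem_freeClass_symm {x y : V} (hx : IsFree P x) (h : y ∈ freeClass G P x) :
    x ∈ freeClass G P y := by
  obtain ⟨-, rfl | h | ⟨c, hc, hcx, hcy⟩⟩ := mem_freeClass.1 h
  · exact h
  · exact mem_freeClass.2 ⟨hx, Or.inr (Or.inl h.symm)⟩
  · exact mem_freeClass.2 ⟨hx, Or.inr (Or.inr ⟨c, hc, hcy, hcx⟩)⟩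

/-- `freeClass` only reaches distance two. This already gives components, since anything further
would produce four free vertices on a path. -/
theorem IsOptimal.mem_freeClass_trans (hP : IsOptimal G L P) {x y z : V} (hx : IsFree P x)
    (hxy : y ∈ freeClass G P x) (hyz : z ∈ freeClass G P y) : z ∈ freeClass G P x := by
  obtain ⟨hy, hxy⟩ := mem_freeClass.1 hxy
  obtain ⟨hz, hyz⟩ := mem_freeClass.1 hyz
  refine mem_freeClass.2 ⟨hz, ?_⟩
  by_cases hzx : z = x
  · exact Or.inl hzx
  rcases hxy with rfl | hxy | ⟨c, hc, hcx, hcy⟩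
  · exact hyz
  · rcases hyz with rfl | hyz | ⟨e, he, hey, hez⟩
    · exact Or.inr (Or.inl hxy)
    · exact Or.inr (Or.inr ⟨y, hy, hxy.symm, hyz⟩)
    · by_cases h1 : e = x
      · exact Or.inr (Or.inl (h1 ▸ hez))
      by_cases h2 : z = y
      · exact Or.inr (Or.inl (h2 ▸ hxy))
      exact (hP.no_free_four hx hy he hz hxy hey.symm hez (Ne.symm h1) (Ne.symm h2)
        (Ne.symm hzx)).elim
  · by_cases h3 : y = x
    · subst h3
      exact hyz
    rcases hyz with rfl | hyz | ⟨e, he, hey, hez⟩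
    · exact Or.inr (Or.inr ⟨c, hc, hcx, hcy⟩)
    · by_cases h1 : z = c
      · exact Or.inr (Or.inl (h1 ▸ hcx.symm))
      exact (hP.no_free_four hx hc hy hz hcx.symm hcy hyz (Ne.symm h3) (Ne.symm h1)
        (Ne.symm hzx)).elim
    · by_cases h1 : e = c
      · exact Or.inr (Or.inr ⟨c, hc, hcx, h1 ▸ hez⟩)
      by_cases h2 : e = x
      · exact Or.inr (Or.inl (h2 ▸ hez))
      exact (hP.no_free_four hx hc hy he hcx.symm hcy hey.symm (Ne.symm h3) (Ne.symm h1)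
        (Ne.symm h2)).elim

theorem IsOptimal.freeClass_eq (hP : IsOptimal G L P) {x y : V} (hx : IsFree P x)
    (h : y ∈ freeClass G P x) : freeClass G P y = freeClass G P x := by
  have hy := (mem_freeClass.1 h).1
  ext z
  exact ⟨fun hz => hP.mem_freeClass_trans hx h hz,
    fun hz => hP.mem_freeClass_trans hy (mem_freeClass_symm hx h) hz⟩

/-- A component of the free part is a star. -/
theorem IsOptimal.exists_center (hG : Setting G L) (hP : IsOptimal G L P) {x : V}
    (hx : IsFree P x) :
    ∃ c ∈ freeClass G P x, ∀ y ∈ freeClass G P x, y ≠ c → G.Adj c y := by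
  by_cases h : ∃ c ∈ freeClass G P x, ∃ a b, a ≠ b ∧ IsFree P a ∧ IsFree P b ∧ G.Adj c a ∧ G.Adj c b
  · obtain ⟨c, hcx, a, b, hab, ha, hb, hca, hcb⟩ := h
    have hc := (mem_freeClass.1 hcx).1
    refine ⟨c, hcx, fun y hy hyc => ?_⟩
    rw [← hP.freeClass_eq hx hcx] at hy
    obtain ⟨hy, rfl | h | ⟨e, he, hec, hey⟩⟩ := mem_freeClass.1 hy
    · exact absurd rfl hyc
    · exact h
    · exfalso
      have key : ∀ a, a ≠ e → IsFree P a → G.Adj c a → False := fun a hae ha hca =>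
        hP.no_free_four hy he hc ha hey.symm hec hca hyc (Ne.symm hae)
          (fun e' => hG.no_triangle _ _ _ hec hca (e' ▸ hey))
      by_cases e' : a = e
      · exact key b (fun e'' => hab (e'.trans e''.symm)) hb hcb
      · exact key a e' ha hca
  · push Not at h
    refine ⟨x, mem_freeClass_self hx, fun y hy hyx => ?_⟩
    obtain ⟨hyf, rfl | h' | ⟨c, hc, hcx, hcy⟩⟩ := mem_freeClass.1 hy
    · exact absurd rfl hyx
    · exact h'
    · exact absurd hcy (h c (mem_freeClass.2 ⟨hc, Or.inr (Or.inl hcx.symm)⟩) x y (Ne.symm hyx) hx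
        hyf hcx)

/-- The edge vw is a tail of two free vertices, which by `free_edge_attach` fits only at inner
vertices of paths with five to seven vertices. -/
theorem IsOptimal.hooked_of_free_edge (hP : IsOptimal G L P) {v w u : V} (hv : IsFree P v)
    (hw : IsFree P w) (hvw : G.Adj v w) (hvu : G.Adj v u) (hu : ¬ IsFree P u) :
    v ∈ hooked G P := by
  obtain ⟨p, hp, hup⟩ := exists_mem_of_not_isFree hu
  obtain ⟨l₁, l₂, rfl⟩ := List.append_of_mem hup
  exact ⟨u, ⟨l₁, l₂, hp, hP.free_edge_attach hp rfl hv hw hvw hvu⟩, hvu⟩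

theorem IsPaired.of_mem {x y : V} (hx : IsPaired G P x) (hy : y ∈ freeClass G P x) :
    IsPaired G P y := by
  obtain ⟨hy, rfl | h | ⟨c, hc, hcx, hcy⟩⟩ := mem_freeClass.1 hy
  · exact hx
  · exact ⟨hy, x, hx.1, h.symm⟩
  · exact ⟨hy, c, hc, hcy.symm⟩

open Classical in
theorem IsOptimal.exists_classCode (hG : Setting G L) (hP : IsOptimal G L P) {x : V}
    (hx : IsPaired G P x) :
    ∃ D ⊆ freeClass G P x, LocalCode G (freeClass G P x : Set V) (D : Set V) (hooked G P) ∧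
      2 * ((freeClass G P x).filter (· ∉ L)).card ≤ 7 * D.card := by
  obtain ⟨c, hc, hstar⟩ := hP.exists_center hG hx.1
  refine exists_starCode hG hc hstar ?_ ?_
  · obtain ⟨hx, y, hy, hxy⟩ := hx
    exact Finset.one_lt_card.2 ⟨x, mem_freeClass_self hx, y,
      mem_freeClass.2 ⟨hy, Or.inr (Or.inl hxy)⟩, hxy.ne⟩
  · intro v hv u hvu
    obtain ⟨hvf, w, hw, hvw⟩ := hx.of_mem hv
    by_cases hu : IsFree P u
    · left
      rw [← hP.freeClass_eq hx.1 hv]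
      exact mem_freeClass.2 ⟨hu, Or.inr (Or.inl hvu)⟩
    · exact Or.inr (hP.hooked_of_free_edge hvf hw hvw hvu hu)

open Classical in
/-- The part of the complement of the code inside the components of the free part with at least
two vertices. -/
theorem IsOptimal.exists_freeCode (hG : Setting G L) (hP : IsOptimal G L P) :
    ∃ E : Set V, (∀ x, IsPaired G P x →
      LocalCode G (freeClass G P x : Set V) {y | y ∈ freeClass G P x ∧ y ∈ E} (hooked G P)) ∧
      2 * (Finset.univ.filter fun x => IsPaired G P x ∧ x ∉ L).card ≤
        7 * (Finset.univ.filter fun x => IsPaired G P x ∧ x ∈ E).card := by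
  -- The choice is made per component rather than per vertex, so that all vertices of a component
  -- see the same D; the value ∅ elsewhere is irrelevant.
  have h : ∀ K : Finset V, ∃ D : Finset V, (∃ x, IsPaired G P x ∧ freeClass G P x = K) →
      D ⊆ K ∧ LocalCode G (K : Set V) (D : Set V) (hooked G P) ∧
        2 * (K.filter (· ∉ L)).card ≤ 7 * D.card := by
    intro K
    by_cases hK : ∃ x, IsPaired G P x ∧ freeClass G P x = K
    · obtain ⟨x, hx, rfl⟩ := hK
      obtain ⟨D, h1, h2, h3⟩ := hP.exists_classCode hG hx
      exact ⟨D, fun _ => ⟨h1, h2, h3⟩⟩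
    · exact ⟨∅, fun h => absurd h hK⟩
  choose D hD using h
  have hD' : ∀ x, IsPaired G P x → ∀ y, (y ∈ freeClass G P x ∧ y ∈ D (freeClass G P y)) ↔
      y ∈ D (freeClass G P x) := by
    intro x hx y
    constructor
    · rintro ⟨h1, h2⟩
      rwa [hP.freeClass_eq hx.1 h1] at h2
    · intro h
      have h1 := (hD _ ⟨x, hx, rfl⟩).1 h
      exact ⟨h1, by rwa [hP.freeClass_eq hx.1 h1]⟩
  obtain ⟨E, hE⟩ : ∃ E : Set V, ∀ y, y ∈ E ↔ y ∈ D (freeClass G P y) :=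
    ⟨{y | y ∈ D (freeClass G P y)}, fun _ => Iff.rfl⟩
  simp only [← hE] at hD'
  refine ⟨E, ?_, ?_⟩
  · intro x hx
    have e : {y | y ∈ freeClass G P x ∧ y ∈ E} = (D (freeClass G P x) : Set V) :=
      Set.ext fun y => hD' x hx y
    rw [e]
    exact (hD _ ⟨x, hx, rfl⟩).2.1
  · set I := (Finset.univ.filter fun x => IsPaired G P x).image (freeClass G P)
    have hI : ∀ x, IsPaired G P x → freeClass G P x ∈ I := fun x hx =>
      Finset.mem_image_of_mem _ (by simpa using hx)
    rw [Finset.card_eq_sum_card_fiberwise (f := freeClass G P) (t := I),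
      Finset.card_eq_sum_card_fiberwise (s := Finset.univ.filter _) (f := freeClass G P) (t := I),
      Finset.mul_sum, Finset.mul_sum]
    · refine Finset.sum_le_sum fun K hK => ?_
      obtain ⟨x, hx, rfl⟩ := Finset.mem_image.1 hK
      replace hx : IsPaired G P x := by simpa using hx
      have h3 := (hD _ ⟨x, hx, rfl⟩).2.2
      refine (Nat.mul_le_mul_left 2 (Finset.card_le_card ?_)).trans
        (h3.trans (Nat.mul_le_mul_left 7 (Finset.card_le_card ?_)))
      · intro y hy
        simp only [Finset.mem_filter, Finset.mem_univ, true_and] at hy ⊢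
        exact ⟨hy.2 ▸ mem_freeClass_self hy.1.1.1, hy.1.2⟩
      · intro y hy
        have h1 := (hD' x hx y).2 hy
        simp only [Finset.mem_filter, Finset.mem_univ, true_and]
        exact ⟨⟨hx.of_mem h1.1, h1.2⟩, hP.freeClass_eq hx.1 h1.1⟩
    · intro x hx
      exact hI x (by simp at hx; exact hx.1)
    · intro x hx
      exact hI x (by simp at hx; exact hx.1)

end GirthFive

/-! ### The complement of the code and the choices behind it -/

namespace GirthFive
open SimpleGraph

variable {V : Type*} {G : SimpleGraph V} {L : Set V} {P : Finset (List V)}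

/-- An inner vertex of a path with at least four vertices has an inner neighbour. -/
theorem IsPathList.exists_adj_not_mem_ends {p : List V} (hp : IsPathList G p) (h4 : 4 ≤ p.length)
    {u : V} (hu : u ∈ p) (hue : u ∉ ends p) : ∃ b ∈ p, b ∉ ends p ∧ G.Adj u b := by
  by_cases h5 : 5 ≤ p.length
  · obtain ⟨a, b, m, y, z, rfl, hm⟩ := exists_eq_of_five_le h5
    have e : a :: b :: (m ++ [y, z]) = [a] ++ ((b :: (m ++ [y])) ++ [z]) := by simp
    have hn := hp.nodup
    rw [e] at hp hn
    have hus : u ∈ b :: (m ++ [y]) := by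
      rw [ends_eq] at hue
      simp at hu hue ⊢
      tauto
    obtain ⟨c, -, hc, -, -, -, huc, -⟩ := hp.right.left.exists_path_three (by simp; omega) hus
    refine ⟨c, by simp at hc ⊢; tauto, ?_, huc⟩
    rw [ends_eq]
    rintro (rfl | rfl)
    · exact (List.nodup_append.1 hn).2.2 c (by simp) c (List.mem_append_left _ hc) rfl
    · exact (List.nodup_append.1 (List.nodup_append.1 hn).2.1).2.2 c hc c (by simp) rfl
  · obtain ⟨a, b, c, d, rfl⟩ : ∃ a b c d, p = [a, b, c, d] := by
      rcases p with _ | ⟨a, _ | ⟨b, _ | ⟨c, _ | ⟨d, _ | ⟨_, _⟩⟩⟩⟩⟩ <;> simp at h4 h5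
      exact ⟨a, b, c, d, rfl⟩
    have hn := hp.nodup
    have hc := hp.chain
    simp at hn hc
    simp [ends] at hu hue
    rcases hu with rfl | rfl | rfl | rfl
    · exact absurd rfl hue.1
    · exact ⟨c, by simp, by simp [ends]; grind, hc.2.1⟩
    · exact ⟨b, by simp, by simp [ends]; grind, hc.2.1.symm⟩
    · exact absurd rfl hue.2

theorem exists_perm_of_mem_ends {q : List V} {w : V} (hq : IsPathList G q) (hw : w ∈ ends q) :
    ∃ t, (w :: t).Perm q ∧ IsPathList G (w :: t) := by
  rcases hw with hw | hw
  · obtain ⟨t, rfl⟩ : ∃ t, q = w :: t := by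
      rcases q with _ | ⟨a, t⟩
      · simp at hw
      · exact ⟨t, by simp at hw; rw [hw]⟩
    exact ⟨t, List.Perm.refl _, hq⟩
  · obtain ⟨t, ht⟩ : ∃ t, q.reverse = w :: t := by
      rw [← List.head?_reverse] at hw
      rcases h : q.reverse with _ | ⟨a, t⟩
      · simp [h] at hw
      · exact ⟨t, by rw [h] at hw; simp at hw; rw [hw]⟩
    exact ⟨t, ht ▸ List.reverse_perm q, ht ▸ hq.reverse⟩

theorem mem_of_mem_ends {q : List V} {w : V} (hw : w ∈ ends q) : w ∈ q := by
  rcases hw with hw | hw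
  · exact List.mem_of_mem_head? hw
  · exact List.mem_of_mem_getLast? hw

/-- The set consisting of the last vertex of a list. -/
def lastSet (p : List V) : Set V := {v | p.getLast? = some v}

/-- The ends of the paths with four vertices. -/
def fourEnds (P : Finset (List V)) : Set V := {w | ∃ q ∈ P, q.length = 4 ∧ w ∈ ends q}

open Classical in
/-- The complement of the code inside a path of the packing. -/
noncomputable def pathCode (L : Set V) (M F T : Finset (List V)) (e : List V → Finset V)
    (opened : Prop) (p : List V) : Set V :=
  if p.length = 4 then
    (if p ∈ F then {v | v ∈ p ∧ v ∉ ends p} else if p ∈ T then ends p else lastSet p)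
  else if p.length = 5 ∧ opened then ∅
  else if p.length = 8 ∧ (∀ v ∈ p, v ∉ L) ∧ p ∉ M then (e p : Set V)
  else ends p

/-- The complement of the code. -/
def codeCompl (G : SimpleGraph V) (L : Set V) (P : Finset (List V)) (c : List V → Set V)
    (E : Set V) : Set V :=
  {v | (∃ p ∈ P, v ∈ p ∧ v ∈ c p) ∨
    (IsFree P v ∧ (IsPaired G P v → v ∈ E) ∧ (¬ IsPaired G P v → v ∉ L))}

theorem ne_nil_of_length {l : List V} (h : 1 ≤ l.length) : l ≠ [] := by
  rintro rfl
  simp at h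

theorem leafCount_pos {p : List V} {v : V} (hv : v ∈ p) (hL : v ∈ L) : 0 < leafCount L p :=
  List.countP_pos_iff.2 ⟨v, hv, by simpa using hL⟩

/-- Apart from paths in F and leafless unmarked paths with eight vertices, all inner vertices stay
in the code and can support vertices attached to them. -/
theorem pathCode_subset_ends {M F T : Finset (List V)} {e : List V → Finset V} {opened : Prop}
    {p : List V} (hF : p ∉ F)
    (h8 : ¬ (p.length = 8 ∧ (∀ v ∈ p, v ∉ L) ∧ p ∉ M)) :
    pathCode L M F T e opened p ⊆ ends p := by
  intro v hv
  unfold pathCode at hv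
  split_ifs at hv
  · exact hv
  · exact Or.inr hv
  · exact absurd hv (Set.notMem_empty v)
  · exact hv

variable [Fintype V]

/-- The choices made in the construction of the code: `E` is the complement of the code in the
nontrivial components of the free part, the paths in `M` are used by trivial components of the free
part, the paths in `F` have their middle vertices outside the code, those in `T` are attached to
paths in `F`. -/
structure CodeData (G : SimpleGraph V) (L : Set V) (P : Finset (List V)) (E : Set V)
    (M F T : Finset (List V)) (e : List V → Finset V) (opened : Prop) : Prop where
  opt : IsOptimal G L P
  free : ∀ x, IsPaired G P x →
    LocalCode G (freeClass G P x : Set V) {y | y ∈ freeClass G P x ∧ y ∈ E} (hooked G P)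
  mark : ∀ x, IsFree P x → ¬ IsPaired G P x → x ∉ L → ∃ a b, a ≠ b ∧ G.Adj x a ∧ G.Adj x b ∧
    (∃ p ∈ P, a ∈ p ∧ p ∈ M) ∧ (∃ p ∈ P, b ∈ p ∧ p ∈ M)
  eight : ∀ p ∈ P, p.length = 8 → (∀ v ∈ p, v ∉ L) →
    IsEightCode G p (hooked G P) (fourEnds P) (e p)
  F_sub : ∀ p ∈ F, p ∈ P ∧ p.length = 4 ∧ (∀ v ∈ p, v ∉ L) ∧ p ∉ M
  T_sub : ∀ p ∈ T, p ∈ P ∧ p.length = 4 ∧ (∀ v ∈ p, v ∉ L) ∧ p ∉ M ∧ p ∉ F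
  F_attach : ∀ q ∈ F, ∀ w ∈ ends q, ∃ u, G.Adj w u ∧ u ∉ q ∧ ∀ p ∈ F, u ∉ p
  T_attach : ∀ p ∈ T, ∃ q ∈ F, ∃ w ∈ ends q, ∃ u ∈ p, G.Adj w u
  opened_of_mem : ∀ p ∈ F, opened

/-- A free vertex is attached only to inner vertices. -/
theorem IsOptimal.not_mem_ends_of_free (hP : IsOptimal G L P) {p : List V} (hp : p ∈ P) {a x : V}
    (ha : a ∈ p) (hx : IsFree P x) (h : G.Adj x a) : a ∉ ends p := by
  obtain ⟨l₁, l₂, rfl⟩ := List.append_of_mem ha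
  have := hP.free_attach hp rfl hx h
  unfold InnerPos at this
  exact not_mem_ends (hP.path _ hp).nodup (ne_nil_of_length (by omega))
    (ne_nil_of_length (by omega))

/-- A free leaf is attached only to paths with five to seven vertices and to paths containing a
leaf. -/
theorem IsOptimal.free_leaf_attach (hP : IsOptimal G L P) {p : List V} (hp : p ∈ P) {a x : V}
    (ha : a ∈ p) (hx : IsFree P x) (hxL : x ∈ L) (h : G.Adj x a) :
    (5 ≤ p.length ∧ p.length ≤ 7) ∨ ∃ v ∈ p, v ∈ L := by
  obtain ⟨l₁, l₂, rfl⟩ := List.append_of_mem ha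
  have hpath := hP.path _ hp
  have hxp := hx _ hp
  -- Here the secondary maximisation is used: a path of the same length through the free leaf x must
  -- not contain more leaves than p, so p already has one.
  have key : ∀ p', IsPathList G p' → p'.length = (l₁ ++ a :: l₂).length → x ∈ p' →
      (∀ v ∈ p', v = x ∨ v ∈ l₁ ++ a :: l₂) → ∃ v ∈ l₁ ++ a :: l₂, v ∈ L := by
    intro p' hp' hlen hxp' hsub
    have h1 := hP.leafCount_le hp hp' hlen (fun v hv => by
      rcases hsub v hv with rfl | h
      · exact Or.inr hx
      · exact Or.inl h)
    have h2 := (leafCount_pos hxp' hxL).trans_le h1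
    obtain ⟨v, hv, hvL⟩ := List.countP_pos_iff.1 h2
    exact ⟨v, hv, by simpa using hvL⟩
  have hpos := hP.free_attach hp rfl hx h
  have hcase : InnerPos l₁.length l₂.length ∨ l₁.length = 1 ∨ l₂.length = 1 := by
    rcases hpos with h | h | h | h
    · exact Or.inl h
    all_goals right; omega
  rcases hcase with hi | h1 | h1
  · left
    unfold InnerPos at hi
    simp
    omega
  -- The vertex a is second on p, and x can replace the first vertex.
  · right
    refine key (x :: a :: l₂) ⟨?_, ?_⟩ (by simp; omega) (by simp) (by simp; tauto)
    · refine List.nodup_cons.2 ⟨fun hx' => hxp (List.mem_append_right _ hx'), hpath.right.nodup⟩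
    · exact List.isChain_cons_cons.2 ⟨h, hpath.right.chain⟩
  · right
    have e : l₁ ++ a :: l₂ = (l₁ ++ [a]) ++ l₂ := by simp
    have hl : IsPathList G (l₁ ++ [a]) := by
      rw [e] at hpath
      exact hpath.left
    refine key ((l₁ ++ [a]) ++ [x]) ⟨?_, ?_⟩ (by simp; omega) (by simp) (by simp; tauto)
    · refine List.nodup_append.2 ⟨hl.nodup, by simp, ?_⟩
      rintro y hy z hz rfl
      rw [List.mem_singleton.1 hz] at hy
      exact hxp (e ▸ List.mem_append_left _ hy)
    · refine List.isChain_append.2 ⟨hl.chain, by simp, ?_⟩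
      simpa using h.symm

end GirthFive

/-! ### Blocks in the free part -/

namespace GirthFive
open SimpleGraph

variable {V : Type*} {G : SimpleGraph V} {L : Set V} {P : Finset (List V)}

theorem IsPacking.mem_codeCompl_iff (hP : IsPacking G P) {c : List V → Set V} {E : Set V}
    {p : List V} (hp : p ∈ P) {v : V} (hv : v ∈ p) : v ∈ codeCompl G L P c E ↔ v ∈ c p := by
  constructor
  · rintro (⟨q, hq, hvq, h⟩ | ⟨h, -⟩)
    · exact hP.eq_of_mem q hq p hp v hvq hv ▸ h
    · exact absurd hv (h p hp)
  · exact fun h => Or.inl ⟨p, hp, hv, h⟩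

theorem mem_codeCompl_iff_of_paired {c : List V → Set V} {E : Set V} {v : V}
    (hv : IsPaired G P v) : v ∈ codeCompl G L P c E ↔ v ∈ E := by
  constructor
  · rintro (⟨q, hq, hvq, h⟩ | ⟨-, h, -⟩)
    · exact absurd hvq (hv.1 q hq)
    · exact h hv
  · exact fun h => Or.inr ⟨hv.1, fun _ => h, fun h' => absurd hv h'⟩

theorem mem_codeCompl_iff_of_not_paired {c : List V → Set V} {E : Set V} {v : V}
    (hf : IsFree P v) (hv : ¬ IsPaired G P v) : v ∈ codeCompl G L P c E ↔ v ∉ L := by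
  constructor
  · rintro (⟨q, hq, hvq, h⟩ | ⟨-, -, h⟩)
    · exact absurd hvq (hf q hq)
    · exact h hv
  · exact fun h => Or.inr ⟨hf, fun h' => absurd h' hv, fun _ => h⟩

variable [Fintype V]

namespace CodeData

variable {E : Set V} {M F T : Finset (List V)} {e : List V → Finset V} {opened : Prop}

theorem anchor (h : CodeData G L P E M F T e opened) {p : List V} (hp : p ∈ P) {u : V}
    (hu : u ∈ p) (hue : u ∉ ends p) (hsub : pathCode L M F T e opened p ⊆ ends p) :
    u ∉ codeCompl G L P (pathCode L M F T e opened) E ∧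
      ∃ b ∈ p, b ∉ codeCompl G L P (pathCode L M F T e opened) E ∧ G.Adj u b := by
  have hP := h.opt.toIsPacking
  obtain ⟨b, hb, hbe, hub⟩ := (hP.path p hp).exists_adj_not_mem_ends (hP.four_le p hp) hu hue
  exact ⟨fun hu' => hue (hsub ((hP.mem_codeCompl_iff hp hu).1 hu')), b, hb,
    fun hb' => hbe (hsub ((hP.mem_codeCompl_iff hp hb).1 hb')), hub⟩

theorem not_mem_F_of_length (h : CodeData G L P E M F T e opened) {p : List V}
    (hlen : p.length ≠ 4) : p ∉ F := fun hp => hlen (h.F_sub p hp).2.1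

theorem anchor_of_inner (h : CodeData G L P E M F T e opened) {l₁ l₂ : List V} {u : V}
    (hp : l₁ ++ u :: l₂ ∈ P) (hi : InnerPos l₁.length l₂.length) :
    u ∉ codeCompl G L P (pathCode L M F T e opened) E ∧
      ∃ b ∈ l₁ ++ u :: l₂, b ∉ codeCompl G L P (pathCode L M F T e opened) E ∧ G.Adj u b := by
  unfold InnerPos at hi
  refine h.anchor hp (by simp) (not_mem_ends (h.opt.path _ hp).nodup (ne_nil_of_length hi.1)
    (ne_nil_of_length hi.2.1)) (pathCode_subset_ends (h.not_mem_F_of_length ?_) ?_)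
  · simp; omega
  · simp; omega

/-- Inner vertices of paths with five to seven vertices stay in the code for every choice of F, T
and `opened`, so `hooked G P` provides the support demanded of H in a local code. -/
theorem hooked_anchor (h : CodeData G L P E M F T e opened) {v : V} (hv : v ∈ hooked G P)
    {K : Set V} (hK : ∀ p ∈ P, 5 ≤ p.length → p.length ≤ 7 → ∀ u ∈ p, u ∉ K) :
    ∃ u b, u ∉ K ∧ u ∉ codeCompl G L P (pathCode L M F T e opened) E ∧ b ∉ K ∧
      b ∉ codeCompl G L P (pathCode L M F T e opened) E ∧ G.Adj v u ∧ G.Adj u b := by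
  obtain ⟨u, ⟨l₁, l₂, hp, hi⟩, hvu⟩ := hv
  obtain ⟨hu, b, hb, hbD, hub⟩ := h.anchor_of_inner hp hi
  have hK' := hK _ hp (by simp; unfold InnerPos at hi; omega) (by simp; unfold InnerPos at hi; omega)
  exact ⟨u, b, hK' u (by simp), hu, hK' b hb, hbD, hvu, hub⟩

theorem goodBlock_freeClass (h : CodeData G L P E M F T e opened) {x : V}
    (hx : IsPaired G P x) :
    GoodBlock G (codeCompl G L P (pathCode L M F T e opened) E) (freeClass G P x : Set V) := by
  refine (h.free x hx).goodBlock ?_ (fun v hv => hv.1) ?_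
  · intro v hv
    rw [mem_codeCompl_iff_of_paired (hx.of_mem hv)]
    exact ⟨fun h => ⟨hv, h⟩, fun h => h.2⟩
  · exact fun v _ hvH => h.hooked_anchor hvH fun p hp _ _ u hu huK =>
      (mem_freeClass.1 huK).1 p hp hu

/-- A nonleaf has two neighbours on marked paths; they are inner vertices and hence in the code. A
leaf belongs to the code, and by `free_leaf_attach` its neighbour lies on a path keeping all its
inner vertices, so the leaf starts a code path with three vertices. -/
theorem goodBlock_singleton (hG : Setting G L) (h : CodeData G L P E M F T e opened) {x : V}
    (hx : IsFree P x) (hx' : ¬ IsPaired G P x) :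
    GoodBlock G (codeCompl G L P (pathCode L M F T e opened) E) {x} := by
  refine ⟨?_, ?_, ?_⟩
  · rintro _ rfl hxD
    have hxL := (mem_codeCompl_iff_of_not_paired hx hx').1 hxD
    obtain ⟨a, b, hab, hxa, hxb, ⟨p, hp, hap, hpM⟩, ⟨q, hq, hbq, hqM⟩⟩ := h.mark _ hx hx' hxL
    have key : ∀ a p, p ∈ P → a ∈ p → p ∈ M → G.Adj _ a →
        a ∉ codeCompl G L P (pathCode L M F T e opened) E := fun a p hp hap hpM hxa =>
      (h.anchor hp hap (h.opt.not_mem_ends_of_free hp hap hx hxa)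
        (pathCode_subset_ends (fun hpF => (h.F_sub p hpF).2.2.2 hpM) (fun h' => h'.2.2 hpM))).1
    exact Or.inl ⟨a, b, hab, key a p hp hap hpM hxa, key b q hq hbq hqM hxb, hxa, hxb⟩
  · rintro _ rfl - _ rfl - _ _ _ _ _ _ _
    rfl
  · rintro _ rfl hxD
    rw [mem_codeCompl_iff_of_not_paired hx hx', not_not] at hxD
    obtain ⟨a, hxa, -⟩ := hG.leaf _ hxD
    have haf : ¬ IsFree P a := fun ha => hx' ⟨hx, a, ha, hxa⟩
    obtain ⟨p, hp, hap⟩ := exists_mem_of_not_isFree haf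
    have hsub : pathCode L M F T e opened p ⊆ ends p := by
      rcases h.opt.free_leaf_attach hp hap hx hxD hxa with h5 | ⟨v, hv, hvL⟩
      · exact pathCode_subset_ends (h.not_mem_F_of_length (by omega)) (by omega)
      · exact pathCode_subset_ends (fun hpF => (h.F_sub p hpF).2.2.1 v hv hvL)
          (fun h' => h'.2.1 v hv hvL)
    obtain ⟨haD, b, hb, hbD, hab⟩ :=
      h.anchor hp hap (h.opt.not_mem_ends_of_free hp hap hx hxa) hsub
    exact Or.inl ⟨a, b, haD, hbD, fun e' => hx p hp (e' ▸ hb), hab.ne, hxa, Or.inr hab⟩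

end CodeData
end GirthFive

/-! ### Blocks formed by the paths of the packing -/

namespace GirthFive
open SimpleGraph

variable {V : Type*} {G : SimpleGraph V} {L : Set V} {P : Finset (List V)}

theorem exists_eq_of_length_eq_four {p : List V} (h : p.length = 4) :
    ∃ a b c d, p = [a, b, c, d] := by
  rcases p with _ | ⟨a, _ | ⟨b, _ | ⟨c, _ | ⟨d, _ | ⟨e, t⟩⟩⟩⟩⟩ <;> simp at h
  exact ⟨a, b, c, d, rfl⟩

theorem length_of_perm_cons {t q : List V} {w : V} {n : ℕ} (h : (w :: t).Perm q)
    (hq : q.length = n + 1) : t.length = n := by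
  have := h.length_eq
  simp at this
  omega

/-- This serves the paths in T. The single code vertex w turns the edge bc into a code component
with at least three vertices. It need not have a code neighbour beyond the path, so `LocalCode` with
its stronger support does not apply. -/
theorem Setting.goodBlock_of_hook (hG : Setting G L) {a b c d w : V} {D : Set V}
    (hp : IsPathList G [a, b, c, d]) (hb : b ∉ D) (hc : c ∉ D) (hw : w ∉ D)
    (hwp : w ∉ [a, b, c, d]) (h : G.Adj w b ∨ G.Adj w c) : GoodBlock G D {v | v ∈ [a, b, c, d]} := by
  have hch := hp.chain
  have hn := hp.nodup
  simp only [List.isChain_cons_cons, List.isChain_singleton, and_true] at hch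
  simp only [List.nodup_cons, List.mem_cons, List.not_mem_nil, or_false, not_or, not_false_eq_true,
    List.nodup_nil, and_true] at hn hwp
  obtain ⟨hab, hbc, hcd⟩ := hch
  have hbig : Big G D b ∧ Big G D c := by
    rcases h with h | h
    · exact ⟨⟨c, w, hc, hw, hwp.2.1, fun e => hwp.2.2.1 e.symm, hbc, Or.inl h.symm⟩,
        ⟨b, w, hb, hw, hwp.2.2.1, fun e => hwp.2.1 e.symm, hbc.symm, Or.inr h.symm⟩⟩
    · exact ⟨⟨c, w, hc, hw, hwp.2.1, fun e => hwp.2.2.1 e.symm, hbc, Or.inr h.symm⟩,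
        ⟨b, w, hb, hw, hwp.2.2.1, fun e => hwp.2.1 e.symm, hbc.symm, Or.inl h.symm⟩⟩
  have hcases : ∀ x ∈ {v | v ∈ [a, b, c, d]}, x = a ∨ x = b ∨ x = c ∨ x = d := by simp
  have hD : ∀ x ∈ {v | v ∈ [a, b, c, d]}, x ∈ D → x = a ∨ x = d := by
    intro x hx hxD
    rcases hcases x hx with rfl | rfl | rfl | rfl
    · exact Or.inl rfl
    · exact absurd hxD hb
    · exact absurd hxD hc
    · exact Or.inr rfl
  have hac : ∀ x ∈ {v | v ∈ [a, b, c, d]}, x ∉ D → G.Adj a x → ¬ G.Adj d x := by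
    intro x hx hxD hax hdx
    rcases hcases x hx with rfl | rfl | rfl | rfl
    · exact G.loopless.irrefl _ hax
    · exact hG.no_triangle _ _ _ hbc hcd hdx.symm
    · exact hG.no_triangle _ _ _ hab hbc hax
    · exact G.loopless.irrefl _ hdx
  refine ⟨?_, ?_, ?_⟩
  · intro x hx hxD
    rcases hD x hx hxD with rfl | rfl
    · exact Or.inr ⟨b, by simp, hb, hab⟩
    · exact Or.inr ⟨c, by simp, hc, hcd.symm⟩
  · intro x hx hxD y hy hyD z hz hzD hxz hyz _ _
    rcases hD x hx hxD with rfl | rfl <;> rcases hD y hy hyD with rfl | rfl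
    · rfl
    · exact absurd hyz (hac z hz hzD hxz)
    · exact absurd hxz (hac z hz hzD hyz)
    · rfl
  · intro x hx hxD
    rcases hcases x hx with rfl | rfl | rfl | rfl
    · exact Or.inl ⟨b, c, hb, hc, fun e => hn.1.2.1 e.symm, hbc.ne, hab, Or.inr hbc⟩
    · exact Or.inl hbig.1
    · exact Or.inl hbig.2
    · exact Or.inl ⟨c, b, hc, hb, hn.2.1.2, hbc.ne', hcd.symm, Or.inr hbc.symm⟩

variable [Fintype V]

namespace CodeData

variable {E : Set V} {M F T : Finset (List V)} {e : List V → Finset V} {opened : Prop}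

/-- The end of a path in `F` is attached to a vertex `u` of another path, and `u` and some
neighbour of `u` on that path belong to the code. -/
theorem exists_anchor_of_mem_F (h : CodeData G L P E M F T e opened) {q : List V} (hq : q ∈ F)
    {w : V} (hw : w ∈ ends q) :
    ∃ u b, u ∉ q ∧ u ∉ codeCompl G L P (pathCode L M F T e opened) E ∧ b ∉ q ∧
      b ∉ codeCompl G L P (pathCode L M F T e opened) E ∧ G.Adj w u ∧ G.Adj u b := by
  obtain ⟨hqP, hq4, -, -⟩ := h.F_sub q hq
  have hop := h.opened_of_mem q hq
  have hPk := h.opt.toIsPacking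
  obtain ⟨t, hpt, hwt⟩ := exists_perm_of_mem_ends (hPk.path q hqP) hw
  have ht := length_of_perm_cons hpt hq4
  obtain ⟨u, hwu, huq, huF⟩ := h.F_attach q hq w hw
  obtain ⟨p, hp, hup⟩ := exists_mem_of_not_isFree
    (h.opt.four_not_free hqP hpt hwt (Or.inl ht) hwu)
  have hpq : p ≠ q := fun e' => huq (e' ▸ hup)
  have hpF : p ∉ F := fun hpF => huF p hpF hup
  have hnq : ∀ v ∈ p, v ∉ q := fun v hv hvq => hpq (hPk.eq_of_mem p hp q hqP v hv hvq)
  suffices hs : u ∉ codeCompl G L P (pathCode L M F T e opened) E ∧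
      ∃ b ∈ p, b ∉ codeCompl G L P (pathCode L M F T e opened) E ∧ G.Adj u b by
    obtain ⟨hu, b, hb, hbD, hub⟩ := hs
    exact ⟨u, b, huq, hu, hnq b hb, hbD, hwu, hub⟩
  obtain ⟨l₁, l₂, rfl⟩ := List.append_of_mem hup
  have hat := h.opt.four_attach hp hqP hpq (List.Perm.refl _) (hPk.path _ hp) hpt hwt ht hwu
  have hlen : (l₁ ++ u :: l₂).length = l₁.length + l₂.length + 1 := by simp; omega
  have hin : 1 ≤ l₁.length → 1 ≤ l₂.length → u ∉ ends (l₁ ++ u :: l₂) := fun h₁ h₂ =>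
    not_mem_ends (hPk.path _ hp).nodup (ne_nil_of_length h₁) (ne_nil_of_length h₂)
  -- Only here u may be an end of its path. Since F is nonempty, `opened` holds and the whole path
  -- is in the code.
  by_cases h5 : (l₁ ++ u :: l₂).length = 5
  · have hc : pathCode L M F T e opened (l₁ ++ u :: l₂) = ∅ := by
      unfold pathCode
      rw [if_neg (by omega), if_pos ⟨h5, hop⟩]
    have hout : ∀ v ∈ l₁ ++ u :: l₂, v ∉ codeCompl G L P (pathCode L M F T e opened) E :=
      fun v hv hvD => by
        rw [hPk.mem_codeCompl_iff hp hv, hc] at hvD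
        exact hvD
    obtain ⟨c, -, hc, -, -, -, huc, -⟩ := (hPk.path _ hp).exists_path_three (by omega) hup
    exact ⟨hout u hup, c, hc, hout c hc, huc⟩
  · have hi : 1 ≤ l₁.length ∧ 1 ≤ l₂.length := by
      unfold InnerPos at hat
      omega
    by_cases h8 : (l₁ ++ u :: l₂).length = 8 ∧ (∀ v ∈ l₁ ++ u :: l₂, v ∉ L) ∧ l₁ ++ u :: l₂ ∉ M
    · obtain ⟨hu, b, hb, hbD, hub⟩ := (h.eight _ hp h8.1 h8.2.1).2.2.2 w ⟨q, hqP, hq4, hw⟩ u hup hwu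
      have hc : pathCode L M F T e opened (l₁ ++ u :: l₂) = (e (l₁ ++ u :: l₂) : Set V) := by
        unfold pathCode
        rw [if_neg (by omega), if_neg (by omega), if_pos h8]
      refine ⟨fun hu' => hu ?_, b, hb, fun hb' => hbD ?_, hub⟩
      · rwa [hPk.mem_codeCompl_iff hp hup, hc] at hu'
      · rwa [hPk.mem_codeCompl_iff hp hb, hc] at hb'
    · exact h.anchor hp hup (hin hi.1 hi.2) (pathCode_subset_ends hpF h8)

theorem goodBlock_path (hG : Setting G L) (h : CodeData G L P E M F T e opened) {p : List V}
    (hp : p ∈ P) :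
    GoodBlock G (codeCompl G L P (pathCode L M F T e opened) E) {v | v ∈ p} := by
  have hPk := h.opt.toIsPacking
  have hpath := hPk.path p hp
  have hmem : ∀ v ∈ {v | v ∈ p}, v ∈ codeCompl G L P (pathCode L M F T e opened) E ↔
      v ∈ pathCode L M F T e opened p := fun v hv => hPk.mem_codeCompl_iff hp hv
  have hnoH : ∀ v ∈ {v | v ∈ p}, v ∈ (∅ : Set V) → ∃ u b, u ∉ {v | v ∈ p} ∧
      u ∉ codeCompl G L P (pathCode L M F T e opened) E ∧ b ∉ {v | v ∈ p} ∧
      b ∉ codeCompl G L P (pathCode L M F T e opened) E ∧ G.Adj v u ∧ G.Adj u b :=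
    fun v _ hv => hv.elim
  have h4 := hPk.four_le p hp
  have hendsub : ends p ⊆ {v | v ∈ p} := fun v hv => mem_of_mem_ends hv
  by_cases hl : p.length = 4
  · by_cases hpF : p ∈ F
    · have hH : ∀ v ∈ {v | v ∈ p}, v ∈ ends p → ∃ u b, u ∉ {v | v ∈ p} ∧
          u ∉ codeCompl G L P (pathCode L M F T e opened) E ∧ b ∉ {v | v ∈ p} ∧
          b ∉ codeCompl G L P (pathCode L M F T e opened) E ∧ G.Adj v u ∧ G.Adj u b :=
        fun v _ hv => h.exists_anchor_of_mem_F hpF hv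
      obtain ⟨a, b, c, d, rfl⟩ := exists_eq_of_length_eq_four hl
      refine (localCode_middle hpath (H := ends [a, b, c, d]) (by simp [ends])
        (by simp [ends])).goodBlock (fun v hv => (hmem v hv).trans ?_) (by rintro v (rfl | rfl) <;> simp)
        hH
      unfold pathCode
      rw [if_pos hl, if_pos hpF]
      have hn := hpath.nodup
      simp [ends] at hn ⊢
      grind
    · by_cases hpT : p ∈ T
      · obtain ⟨q, hqF, w, hw, u, hu, hwu⟩ := h.T_attach p hpT
        obtain ⟨hqP, hq4, -, -⟩ := h.F_sub q hqF
        have hpq : p ≠ q := fun e' => hpF (e' ▸ hqF)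
        have hwq := mem_of_mem_ends hw
        have hwp : w ∉ p := fun hwp => hpq (hPk.eq_of_mem p hp q hqP w hwp hwq)
        -- Paths in F lose only their middle vertices, so the end w is in the code.
        have hwD : w ∉ codeCompl G L P (pathCode L M F T e opened) E := fun hwD => by
          rw [hPk.mem_codeCompl_iff hqP hwq] at hwD
          unfold pathCode at hwD
          rw [if_pos hq4, if_pos hqF] at hwD
          exact hwD.2 hw
        have hc : pathCode L M F T e opened p = ends p := by
          unfold pathCode
          rw [if_pos hl, if_neg hpF, if_pos hpT]
        rw [hc] at hmem
        obtain ⟨t, hpt, hwt⟩ := exists_perm_of_mem_ends (hPk.path q hqP) hw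
        have ht := length_of_perm_cons hpt hq4
        have hu2 : ∃ l₁ l₂, p = l₁ ++ u :: l₂ ∧ 1 ≤ l₁.length ∧ 1 ≤ l₂.length := by
          obtain ⟨l₁, l₂, rfl⟩ := List.append_of_mem hu
          have hat := h.opt.four_attach hp hqP hpq (List.Perm.refl _) hpath hpt hwt ht hwu
          unfold InnerPos at hat
          simp at hl
          exact ⟨l₁, l₂, rfl, by omega, by omega⟩
        have hue : u ∉ ends p := by
          obtain ⟨l₁, l₂, rfl, h₁, h₂⟩ := hu2
          exact not_mem_ends hpath.nodup (ne_nil_of_length h₁) (ne_nil_of_length h₂)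
        obtain ⟨a, b, c, d, rfl⟩ := exists_eq_of_length_eq_four hl
        have hn := hpath.nodup
        refine hG.goodBlock_of_hook hpath ?_ ?_ hwD hwp ?_
        · rw [hmem b (by simp)]
          simp [ends] at hn ⊢
          grind
        · rw [hmem c (by simp)]
          simp [ends] at hn ⊢
          grind
        · simp [ends] at hu hue
          rcases hu with rfl | rfl | rfl | rfl
          · exact absurd rfl hue.1
          · exact Or.inl hwu
          · exact Or.inr hwu
          · exact absurd rfl hue.2
      · obtain ⟨a, b, c, d, rfl⟩ := exists_eq_of_length_eq_four hl
        refine (localCode_last hpath ∅).goodBlock (fun v hv => (hmem v hv).trans ?_)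
          (by rintro v rfl; simp) hnoH
        unfold pathCode
        rw [if_pos hl, if_neg hpF, if_neg hpT]
        simp [lastSet, eq_comm]
  · by_cases h5 : p.length = 5 ∧ opened
    · refine (localCode_empty hpath (by omega) ∅).goodBlock (fun v hv => (hmem v hv).trans ?_)
        (Set.empty_subset _) hnoH
      unfold pathCode
      rw [if_neg hl, if_pos h5]
    · by_cases h8 : p.length = 8 ∧ (∀ v ∈ p, v ∉ L) ∧ p ∉ M
      · have h8' := h.eight p hp h8.1 h8.2.1
        refine h8'.2.2.1.goodBlock (fun v hv => (hmem v hv).trans ?_) h8'.1 fun v _ hvH =>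
          h.hooked_anchor hvH fun q hq _ _ u hu hup => ?_
        · unfold pathCode
          rw [if_neg hl, if_neg h5, if_pos h8]
        · have := hPk.eq_of_mem q hq p hp u hu hup
          subst this
          omega
      · refine (localCode_ends hpath (by omega) ∅).goodBlock (fun v hv => (hmem v hv).trans ?_)
          hendsub hnoH
        unfold pathCode
        rw [if_neg hl, if_neg h5, if_neg h8]

/-- The vertex sets of the packing paths and the free components partition the graph into good
blocks. -/
theorem isIdentifyingCode (hG : Setting G L) (h : CodeData G L P E M F T e opened) :
    G.IsIdentifyingCode (codeCompl G L P (pathCode L M F T e opened) E)ᶜ := by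
  have hPk := h.opt.toIsPacking
  refine hG.isIdentifyingCode_of_goodBlock
    (fun v => {u | (IsFree P v ∧ u ∈ freeClass G P v) ∨ ∃ p ∈ P, v ∈ p ∧ u ∈ p}) ?_ ?_ ?_
  · intro v
    by_cases hv : IsFree P v
    · exact Or.inl ⟨hv, mem_freeClass_self hv⟩
    · obtain ⟨p, hp, hvp⟩ := exists_mem_of_not_isFree hv
      exact Or.inr ⟨p, hp, hvp, hvp⟩
  · rintro d c (⟨hd, hc⟩ | ⟨p, hp, hdp, hcp⟩)
    · have hc' := (mem_freeClass.1 hc).1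
      have he := h.opt.freeClass_eq hd hc
      ext u
      simp only [Set.mem_ofPred_eq, he]
      constructor
      · rintro (⟨-, hu⟩ | ⟨p, hp, hcp, -⟩)
        · exact Or.inl ⟨hd, hu⟩
        · exact absurd hcp (hc' p hp)
      · rintro (⟨-, hu⟩ | ⟨p, hp, hdp, -⟩)
        · exact Or.inl ⟨hc', hu⟩
        · exact absurd hdp (hd p hp)
    · ext u
      have key : ∀ v ∈ p, (IsFree P v ∧ u ∈ freeClass G P v ∨ ∃ p ∈ P, v ∈ p ∧ u ∈ p) ↔ u ∈ p := by
        intro v hv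
        constructor
        · rintro (⟨hf, -⟩ | ⟨q, hq, hvq, huq⟩)
          · exact absurd hv (hf p hp)
          · exact hPk.eq_of_mem q hq p hp v hvq hv ▸ huq
        · exact fun hu => Or.inr ⟨p, hp, hv, hu⟩
      exact (key c hcp).trans (key d hdp).symm
  · intro v
    by_cases hv : IsFree P v
    · have e1 : {u | (IsFree P v ∧ u ∈ freeClass G P v) ∨ ∃ p ∈ P, v ∈ p ∧ u ∈ p} =
          (freeClass G P v : Set V) := by
        ext u
        constructor
        · rintro (⟨-, hu⟩ | ⟨p, hp, hvp, -⟩)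
          · exact hu
          · exact absurd hvp (hv p hp)
        · exact fun hu => Or.inl ⟨hv, hu⟩
      rw [e1]
      by_cases hv' : IsPaired G P v
      · exact h.goodBlock_freeClass hv'
      · have e2 : (freeClass G P v : Set V) = {v} := by
          ext u
          constructor
          · intro hu
            obtain ⟨hu, rfl | h' | ⟨c, hc, hcv, -⟩⟩ := mem_freeClass.1 hu
            · rfl
            · exact absurd ⟨hv, u, hu, h'⟩ hv'
            · exact absurd ⟨hv, c, hc, hcv.symm⟩ hv'
          · rintro rfl
            exact mem_freeClass_self hv
        rw [e2]
        exact h.goodBlock_singleton hG hv hv'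
    · obtain ⟨p, hp, hvp⟩ := exists_mem_of_not_isFree hv
      have e1 : {u | (IsFree P v ∧ u ∈ freeClass G P v) ∨ ∃ p ∈ P, v ∈ p ∧ u ∈ p} =
          {u | u ∈ p} := by
        ext u
        constructor
        · rintro (⟨hf, -⟩ | ⟨q, hq, hvq, huq⟩)
          · exact absurd hf hv
          · exact hPk.eq_of_mem q hq p hp v hvq hvp ▸ huq
        · exact fun hu => Or.inr ⟨p, hp, hvp, hu⟩
      rw [e1]
      exact h.goodBlock_path hG hp

end CodeData
end GirthFive

/-! ### Counting -/

namespace GirthFive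
open SimpleGraph

variable {V : Type*} {G : SimpleGraph V} {L : Set V} {P : Finset (List V)}

open Classical in
theorem card_filter_le_length (p : List V) (Q : V → Prop) [DecidablePred Q] :
    (p.toFinset.filter Q).card ≤ p.length :=
  (Finset.card_filter_le _ _).trans (List.toFinset_card_le p)

open Classical in
theorem card_filter_lt_length {p : List V} {Q : V → Prop} [DecidablePred Q] {v : V} (hv : v ∈ p) (hQ : ¬ Q v) :
    (p.toFinset.filter Q).card < p.length :=
  (Finset.card_lt_card (Finset.filter_ssubset.2 ⟨v, by simpa using hv, hQ⟩)).trans_le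
    (List.toFinset_card_le p)

open Classical in
theorem IsPathList.two_le_card_ends {p : List V} (hp : IsPathList G p) (h : 2 ≤ p.length) :
    2 ≤ (p.toFinset.filter (· ∈ ends p)).card := by
  obtain ⟨a, t, rfl⟩ : ∃ a t, p = a :: t := List.exists_cons_of_length_pos (by omega)
  have ht : t ≠ [] := by rintro rfl; simp at h
  refine Finset.one_lt_card.2 ⟨a, by simp [ends], t.getLast ht, ?_, ?_⟩
  · simp [ends, List.getLast?_cons, List.getLast?_eq_some_getLast ht]
  · rintro e
    exact (List.nodup_cons.1 hp.nodup).1 (e ▸ List.getLast_mem ht)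

open Classical in
-- The account of one path. A path in F or T has a second vertex in D, hence the 7. The 1 for U is 8
-- − 7. The 2 for M covers 16 − 14 on eight vertices and 8 − 7 on four. A path with five vertices
-- has surplus 14 − 10 = 4 normally and debt 10 when emptied. Paths with four or eight vertices
-- containing a leaf owe 2 less and break even.
theorem length_inequality {M F T U : Finset (List V)} {e : List V → Finset V} {opened : Prop}
    {p : List V} (hp : IsPathList G p) (h4 : 4 ≤ p.length) (h8 : p.length ≤ 8)
    (hF : p ∈ F → p.length = 4 ∧ (∀ v ∈ p, v ∉ L) ∧ p ∉ M)
    (hT : p ∈ T → p.length = 4 ∧ (∀ v ∈ p, v ∉ L) ∧ p ∉ M ∧ p ∉ F)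
    (he : p.length = 8 → (∀ v ∈ p, v ∉ L) → (∀ v ∈ e p, v ∈ p) ∧ (e p).card = 3)
    (hU : p.length = 4 → (∀ v ∈ p, v ∉ L) → p ∉ M → p ∈ U) :
    2 * (p.toFinset.filter (· ∉ L)).card + (if p ∈ F then 7 else 0) + (if p ∈ T then 7 else 0) +
      (if p.length = 5 then (if opened then 0 else 4) else 0) ≤
    7 * (p.toFinset.filter (· ∈ pathCode L M F T e opened p)).card + (if p ∈ M then 2 else 0) +
      (if p ∈ U then 1 else 0) + (if p.length = 5 then (if opened then 10 else 0) else 0) := by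
  have hn := card_filter_le_length p (· ∉ L)
  have hn' : (∀ v ∈ p, v ∉ L) ∨ (p.toFinset.filter (· ∉ L)).card < p.length := by
    by_contra! h
    exact absurd h.2 (by
      obtain ⟨v, hv, hvL⟩ := h.1
      exact not_le.2 (card_filter_lt_length hv (not_not.2 hvL)))
  have hends := hp.two_le_card_ends (by omega)
  by_cases hl : p.length = 4
  · obtain ⟨a, b, c, d, rfl⟩ := exists_eq_of_length_eq_four hl
    have hnd := hp.nodup
    by_cases hpF : [a, b, c, d] ∈ F
    · have hm : 2 ≤ ([a, b, c, d].toFinset.filter (· ∈ pathCode L M F T e opened [a, b, c, d])).card := by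
        refine Finset.one_lt_card.2 ⟨b, ?_, c, ?_, ?_⟩ <;> simp [pathCode, hpF, ends] at hnd ⊢ <;> grind
      have hpT : [a, b, c, d] ∉ T := fun h => (hT h).2.2.2 hpF
      have hUp := hU hl (hF hpF).2.1 (hF hpF).2.2
      rw [if_pos hpF, if_neg hpT, if_neg (by simp), if_pos hUp]
      simp only [hl] at hn
      omega
    · by_cases hpT : [a, b, c, d] ∈ T
      · have hc : pathCode L M F T e opened [a, b, c, d] = ends [a, b, c, d] := by
          simp [pathCode, hpF, hpT]
        have hUp := hU hl (hT hpT).2.1 (hT hpT).2.2.1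
        rw [if_neg hpF, if_pos hpT, if_neg (by simp), if_pos hUp, hc]
        simp only [hl] at hn
        omega
      · have hm : 1 ≤ ([a, b, c, d].toFinset.filter (· ∈ pathCode L M F T e opened [a, b, c, d])).card := by
          refine Finset.card_pos.2 ⟨d, ?_⟩
          simp [pathCode, hpF, hpT, lastSet]
        rw [if_neg hpF, if_neg hpT, if_neg (by simp)]
        simp only [hl] at hn hn'
        by_cases hM : [a, b, c, d] ∈ M
        · rw [if_pos hM]
          omega
        · rcases hn' with h | h
          · rw [if_pos (hU hl h hM)]
            omega
          · omega
  · have hpF : p ∉ F := fun h => hl (hF h).1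
    have hpT : p ∉ T := fun h => hl (hT h).1
    rw [if_neg hpF, if_neg hpT]
    by_cases h5 : p.length = 5
    · by_cases ho : opened
      · simp only [h5, ho, if_true]
        omega
      · have hc : pathCode L M F T e opened p = ends p := by simp [pathCode, h5, ho]
        rw [hc, if_pos h5, if_pos h5, if_neg ho, if_neg ho]
        omega
    · rw [if_neg h5, if_neg h5]
      by_cases hs : p.length = 8 ∧ (∀ v ∈ p, v ∉ L) ∧ p ∉ M
      · have hc : pathCode L M F T e opened p = (e p : Set V) := by
          unfold pathCode
          rw [if_neg hl, if_neg (by omega), if_pos hs]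
        obtain ⟨he1, he2⟩ := he hs.1 hs.2.1
        have hf : p.toFinset.filter (· ∈ pathCode L M F T e opened p) = e p := by
          rw [hc]
          ext v
          simpa using he1 v
        rw [hf, he2]
        omega
      · have hc : pathCode L M F T e opened p = ends p := by
          unfold pathCode
          rw [if_neg hl, if_neg (by omega), if_neg hs]
        rw [hc]
        split_ifs with h1 <;> try omega
        all_goals
          by_cases h88 : p.length = 8
          · rcases hn' with h | h
            · exact absurd ⟨h88, h, h1⟩ hs
            · omega
          · omega

variable [Fintype V]

open Classical in
theorem IsPacking.card_filter (hP : IsPacking G P) (Q : V → Prop) [DecidablePred Q] :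
    (Finset.univ.filter Q).card =
      ∑ p ∈ P, (p.toFinset.filter Q).card + (Finset.univ.filter fun v => IsFree P v ∧ Q v).card := by
  rw [← Finset.card_biUnion, ← Finset.card_union_of_disjoint]
  · congr 1
    ext v
    simp only [Finset.mem_filter, Finset.mem_univ, true_and, Finset.mem_union, Finset.mem_biUnion,
      List.mem_toFinset]
    constructor
    · intro hQ
      by_cases hv : IsFree P v
      · exact Or.inr ⟨hv, hQ⟩
      · obtain ⟨p, hp, hvp⟩ := exists_mem_of_not_isFree hv
        exact Or.inl ⟨p, hp, hvp, hQ⟩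
    · rintro (⟨p, -, -, hQ⟩ | ⟨-, hQ⟩) <;> exact hQ
  · refine Finset.disjoint_left.2 fun v hv hv' => ?_
    simp only [Finset.mem_filter, Finset.mem_univ, true_and, Finset.mem_biUnion,
      List.mem_toFinset] at hv hv'
    obtain ⟨p, hp, hvp, -⟩ := hv
    exact hv'.1 p hp hvp
  · intro p hp q hq hpq
    refine Finset.disjoint_left.2 fun v hv hv' => hpq ?_
    simp only [Finset.mem_filter, List.mem_toFinset] at hv hv'
    exact hP.eq_of_mem p hp q hq v hv.1 hv'.1

open Classical in
theorem card_filter_free (Q : V → Prop) [DecidablePred Q] :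
    (Finset.univ.filter fun v => IsFree P v ∧ Q v).card =
      (Finset.univ.filter fun v => IsPaired G P v ∧ Q v).card +
        (Finset.univ.filter fun v => IsFree P v ∧ ¬ IsPaired G P v ∧ Q v).card := by
  rw [← Finset.card_union_of_disjoint]
  · congr 1
    ext v
    simp only [Finset.mem_filter, Finset.mem_univ, true_and, Finset.mem_union]
    have : IsPaired G P v → IsFree P v := fun h => h.1
    tauto
  · refine Finset.disjoint_left.2 fun v hv hv' => ?_
    simp only [Finset.mem_filter, Finset.mem_univ, true_and] at hv hv'
    exact hv'.2.1 hv.1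

open Classical in
-- The sum of all accounts. Each nonleaf isolated in the free part earns 7, which covers its own 2
-- and the 2 for each of the at most two paths it marks.
theorem CodeData.card_le {E : Set V} {M F T U : Finset (List V)} {e : List V → Finset V}
    {opened : Prop} (h : CodeData G L P E M F T e opened)
    (hU : ∀ p, p ∈ U ↔ p ∈ P ∧ p.length = 4 ∧ (∀ v ∈ p, v ∉ L) ∧ p ∉ M) (hM : M ⊆ P)
    (hMc : M.card ≤
      2 * (Finset.univ.filter fun x => IsFree P x ∧ ¬ IsPaired G P x ∧ x ∉ L).card)
    (hE : 2 * (Finset.univ.filter fun x => IsPaired G P x ∧ x ∉ L).card ≤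
      7 * (Finset.univ.filter fun x => IsPaired G P x ∧ x ∈ E).card) :
    2 * (Finset.univ.filter fun x => x ∉ L).card + 7 * F.card + 7 * T.card +
      (if opened then 0 else 4) * (P.filter fun p => p.length = 5).card ≤
    7 * (Finset.univ.filter fun x => x ∈ codeCompl G L P (pathCode L M F T e opened) E).card +
      U.card + (if opened then 10 else 0) * (P.filter fun p => p.length = 5).card := by
  have hPk := h.opt.toIsPacking
  set D := codeCompl G L P (pathCode L M F T e opened) E with hD
  have hsum := Finset.sum_le_sum fun p (hp : p ∈ P) =>
    length_inequality (L := L) (M := M) (F := F) (T := T) (U := U) (e := e) (opened := opened)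
      (hPk.path p hp) (hPk.four_le p hp) (hPk.le_eight p hp) (fun hpF => (h.F_sub p hpF).2)
      (fun hpT => (h.T_sub p hpT).2) (fun h8 hL => ⟨(h.eight p hp h8 hL).1, (h.eight p hp h8 hL).2.1⟩)
      (fun h1 h2 h3 => (hU p).2 ⟨hp, h1, h2, h3⟩)
  have hcard : ∀ S ⊆ P, ∀ k, ∑ p ∈ P, (if p ∈ S then k else 0) = k * S.card := by
    intro S hS k
    rw [← Finset.sum_filter, Finset.sum_const, Finset.filter_mem_eq_inter,
      Finset.inter_eq_right.2 hS, smul_eq_mul, mul_comm]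
  have h5 : ∀ k, ∑ p ∈ P, (if p.length = 5 then k else 0) =
      k * (P.filter fun p => p.length = 5).card := by
    intro k
    rw [← Finset.sum_filter, Finset.sum_const, smul_eq_mul, mul_comm]
  have hpD : ∑ p ∈ P, (p.toFinset.filter (· ∈ pathCode L M F T e opened p)).card =
      ∑ p ∈ P, (p.toFinset.filter (· ∈ D)).card := by
    refine Finset.sum_congr rfl fun p hp => ?_
    congr 1
    refine Finset.filter_congr fun v hv => ?_
    exact (hPk.mem_codeCompl_iff hp (List.mem_toFinset.1 hv)).symm
  simp only [Finset.sum_add_distrib, ← Finset.mul_sum, hpD, h5] at hsum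
  rw [hcard F (fun p hp => (h.F_sub p hp).1), hcard T (fun p hp => (h.T_sub p hp).1), hcard M hM,
    hcard U (fun p hp => ((hU p).1 hp).1)] at hsum
  have e1 : (Finset.univ.filter fun v => IsPaired G P v ∧ v ∈ D) =
      Finset.univ.filter fun x => IsPaired G P x ∧ x ∈ E :=
    Finset.filter_congr fun v _ => and_congr_right fun hv => mem_codeCompl_iff_of_paired hv
  have e2 : (Finset.univ.filter fun v => IsFree P v ∧ ¬ IsPaired G P v ∧ v ∈ D) =
      Finset.univ.filter fun x => IsFree P x ∧ ¬ IsPaired G P x ∧ x ∉ L :=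
    Finset.filter_congr fun v _ => and_congr_right fun hv => and_congr_right fun hv' =>
      mem_codeCompl_iff_of_not_paired hv hv'
  rw [hPk.card_filter (fun x => x ∉ L), hPk.card_filter (fun x => x ∈ D),
    card_filter_free (G := G) (fun x => x ∉ L), card_filter_free (G := G) (fun x => x ∈ D), e1, e2]
  omega

end GirthFive

/-! ### Making the choices, and comparing the two codes -/

namespace GirthFive
open SimpleGraph

variable {V : Type*} {G : SimpleGraph V} {L : Set V} {P : Finset (List V)}

/-- An end of a path with four vertices that is not a leaf has a neighbour outside the path. -/
theorem Setting.exists_adj_not_mem (hG : Setting G L) {w : V} {t : List V}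
    (h : IsPathList G (w :: t)) (ht : t.length = 3) (hw : w ∉ L) : ∃ u, G.Adj w u ∧ u ∉ w :: t := by
  obtain ⟨b, c, d, rfl⟩ := List.length_eq_three.1 ht
  have hch := h.chain
  have hn := h.nodup
  simp only [List.isChain_cons_cons, List.isChain_singleton, and_true] at hch
  simp only [List.nodup_cons, List.mem_cons, List.not_mem_nil, or_false, not_or, not_false_eq_true,
    List.nodup_nil, and_true] at hn
  obtain ⟨hwb, hbc, hcd⟩ := hch
  obtain ⟨u, hub, hwu⟩ : ∃ u, u ≠ b ∧ G.Adj w u := by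
    obtain ⟨x, y, hxy, hwx, hwy⟩ := hG.exists_two w hw
    by_cases hx : x = b
    · exact ⟨y, fun e => hxy (hx.trans e.symm), hwy⟩
    · exact ⟨x, hx, hwx⟩
  refine ⟨u, hwu, ?_⟩
  simp only [List.mem_cons, List.not_mem_nil, or_false, not_or]
  refine ⟨hwu.ne', hub, ?_, ?_⟩
  · rintro rfl
    exact hG.no_triangle _ _ _ hwb hbc hwu
  · rintro rfl
    rcases hG.no_square _ _ _ _ hwb hbc hcd hwu.symm with e | e
    · exact hn.1.2.1 e
    · exact hn.2.1.2 e

variable [Fintype V]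

/-- By `eight_attach` an end of any path on these vertices leaves them only towards `inner P`, and
by `four_attach` ends of paths with four vertices meet them only in the two middle positions. -/
theorem IsOptimal.exists_eightCode (hG : Setting G L) (hP : IsOptimal G L P) {p : List V}
    (hp : p ∈ P) (h8 : p.length = 8) (hL : ∀ v ∈ p, v ∉ L) :
    ∃ D, IsEightCode G p (hooked G P) (fourEnds P) D := by
  refine GirthFive.exists_eightCode hG (hP.path p hp) h8 ?_ ?_
    (fun v hv => hL v (List.mem_of_mem_head? hv)) (fun v hv => hL v (List.mem_of_mem_getLast? hv))
  · intro w t hperm hpath a ha hwa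
    have ht := length_of_perm_cons hperm h8
    obtain ⟨q, hq, haq⟩ := exists_mem_of_not_isFree (hP.four_not_free hp hperm hpath (Or.inr ht) hwa)
    obtain ⟨l₁, l₂, rfl⟩ := List.append_of_mem haq
    exact ⟨a, ⟨l₁, l₂, hq, hP.eight_attach hq hp (fun e => ha (e ▸ haq)) rfl hperm hpath ht hwa⟩, hwa⟩
  · rintro l₁ l₂ a hperm hpath w ⟨q, hq, hq4, hw⟩ hwa
    obtain ⟨t, hpt, hwt⟩ := exists_perm_of_mem_ends (hP.path q hq) hw
    have hat := hP.four_attach hp hq (fun e => by rw [e] at h8; omega) hperm hpath hpt hwt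
      (length_of_perm_cons hpt hq4) hwa
    have hlen := hperm.length_eq
    simp only [List.length_append, List.length_cons] at hlen
    unfold InnerPos at hat
    omega

open Classical in
theorem exists_marked (hG : Setting G L) :
    ∃ M ⊆ P, M.card ≤
        2 * (Finset.univ.filter fun x => IsFree P x ∧ ¬ IsPaired G P x ∧ x ∉ L).card ∧
      ∀ x, IsFree P x → ¬ IsPaired G P x → x ∉ L → ∃ a b, a ≠ b ∧ G.Adj x a ∧ G.Adj x b ∧
        (∃ p ∈ P, a ∈ p ∧ p ∈ M) ∧ (∃ p ∈ P, b ∈ p ∧ p ∈ M) := by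
  set B := Finset.univ.filter fun x => IsFree P x ∧ ¬ IsPaired G P x ∧ x ∉ L with hB
  have h : ∀ x, ∃ a b, ∃ p q : List V, x ∈ B → a ≠ b ∧ G.Adj x a ∧ G.Adj x b ∧ (p ∈ P ∧ a ∈ p) ∧
      (q ∈ P ∧ b ∈ q) := by
    intro x
    by_cases hx : x ∈ B
    · obtain ⟨-, hf, hn, hxL⟩ := Finset.mem_filter.1 hx
      have key : ∀ a, G.Adj x a → ∃ p ∈ P, a ∈ p := fun a hxa =>
        exists_mem_of_not_isFree fun ha => hn ⟨hf, a, ha, hxa⟩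
      obtain ⟨a, b, hab, hxa, hxb⟩ := hG.exists_two x hxL
      obtain ⟨p, hp⟩ := key a hxa
      obtain ⟨q, hq⟩ := key b hxb
      exact ⟨a, b, p, q, fun _ => ⟨hab, hxa, hxb, hp, hq⟩⟩
    · exact ⟨x, x, [], [], fun h => absurd h hx⟩
  choose a b f g h using h
  refine ⟨B.image f ∪ B.image g, ?_, ?_, ?_⟩
  · intro p hp
    rcases Finset.mem_union.1 hp with hp | hp
    · obtain ⟨x, hx, rfl⟩ := Finset.mem_image.1 hp
      exact (h x hx).2.2.2.1.1
    · obtain ⟨x, hx, rfl⟩ := Finset.mem_image.1 hp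
      exact (h x hx).2.2.2.2.1
  · have h1 := Finset.card_union_le (B.image f) (B.image g)
    have h2 := Finset.card_image_le (s := B) (f := f)
    have h3 := Finset.card_image_le (s := B) (f := g)
    omega
  · intro x hf hn hxL
    have hx : x ∈ B := Finset.mem_filter.2 ⟨Finset.mem_univ _, hf, hn, hxL⟩
    obtain ⟨hab, hxa, hxb, ⟨hp, hap⟩, ⟨hq, hbq⟩⟩ := h x hx
    exact ⟨a x, b x, hab, hxa, hxb,
      ⟨f x, hp, hap, Finset.mem_union_left _ (Finset.mem_image_of_mem f hx)⟩,
      ⟨g x, hq, hbq, Finset.mem_union_right _ (Finset.mem_image_of_mem g hx)⟩⟩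

open Classical in
-- Choose for each end of each path in U one neighbour off the path, and draw an arc from q to every
-- other path of U containing a neighbour chosen for q. F is an independent set dominating half of
-- U, and T consists of the dominated paths outside F. Independence keeps the chosen neighbours off
-- F.
theorem exists_middle_and_attached (hG : Setting G L) (hP : IsPacking G P) {U : Finset (List V)}
    (hU : ∀ p ∈ U, p ∈ P ∧ p.length = 4 ∧ ∀ v ∈ p, v ∉ L) :
    ∃ F ⊆ U, ∃ T ⊆ U, (∀ p ∈ T, p ∉ F) ∧ U.card ≤ 2 * (F.card + T.card) ∧
      (∀ q ∈ F, ∀ w ∈ ends q, ∃ u, G.Adj w u ∧ u ∉ q ∧ ∀ p ∈ F, u ∉ p) ∧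
      ∀ p ∈ T, ∃ q ∈ F, ∃ w ∈ ends q, ∃ u ∈ p, G.Adj w u := by
  have h : ∀ (q : List V) (w : V), ∃ u, q ∈ U → w ∈ ends q → G.Adj w u ∧ u ∉ q := by
    intro q w
    by_cases hq : q ∈ U ∧ w ∈ ends q
    · obtain ⟨hqP, hq4, hqL⟩ := hU q hq.1
      obtain ⟨t, hpt, hwt⟩ := exists_perm_of_mem_ends (hP.path q hqP) hq.2
      obtain ⟨u, hwu, hu⟩ := hG.exists_adj_not_mem hwt (length_of_perm_cons hpt hq4)
        (hqL w (mem_of_mem_ends hq.2))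
      exact ⟨u, fun _ _ => ⟨hwu, fun hu' => hu (hpt.mem_iff.2 hu')⟩⟩
    · exact ⟨w, fun h₁ h₂ => absurd ⟨h₁, h₂⟩ hq⟩
  choose f hf using h
  obtain ⟨F, hFU, hF, hc⟩ := exists_independent_dominating_half
    (fun q p : List V => q ≠ p ∧ ∃ w ∈ ends q, f q w ∈ p) (fun q h => h.1 rfl) U
  refine ⟨F, hFU, U.filter fun p => p ∉ F ∧ ∃ q ∈ F, q ≠ p ∧ ∃ w ∈ ends q, f q w ∈ p,
    Finset.filter_subset _ _, fun p hp => (Finset.mem_filter.1 hp).2.1, hc.trans ?_, ?_, ?_⟩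
  · refine Nat.mul_le_mul_left 2 ((Finset.card_le_card ?_).trans (Finset.card_union_le _ _))
    intro p hp
    obtain ⟨hpU, hp⟩ := (@Finset.mem_filter _ _ (_) _ _).1 hp
    by_cases hpF : p ∈ F
    · exact Finset.mem_union_left _ hpF
    · exact Finset.mem_union_right _ (Finset.mem_filter.2 ⟨hpU, hpF, hp.resolve_left hpF⟩)
  · intro q hq w hw
    obtain ⟨h1, h2⟩ := hf q w (hFU hq) hw
    exact ⟨f q w, h1, h2, fun p hp hup => hF q hq p hp ⟨fun e => h2 (e ▸ hup), w, hw, hup⟩⟩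
  · intro p hp
    obtain ⟨-, -, q, hq, -, w, hw, hu⟩ := Finset.mem_filter.1 hp
    exact ⟨q, hq, w, hw, f q w, hu, (hf q w (hFU hq) hw).1⟩

open Classical in
/-- In a graph as in `Setting` there is an identifying code whose complement contains at least two
sevenths as many vertices as there are nonleaves. -/
theorem Setting.exists_isIdentifyingCode (hG : Setting G L) :
    ∃ D : Finset V, G.IsIdentifyingCode (D : Set V)ᶜ ∧
      2 * (Finset.univ.filter fun x => x ∉ L).card ≤ 7 * D.card := by
  obtain ⟨P, hP⟩ := exists_isOptimal G L
  obtain ⟨E, hE, hEc⟩ := hP.exists_freeCode hG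
  obtain ⟨M, hM, hMc, hmark⟩ := exists_marked (P := P) hG
  set U := P.filter fun p => p.length = 4 ∧ (∀ v ∈ p, v ∉ L) ∧ p ∉ M with hUdef
  have hU : ∀ p, p ∈ U ↔ p ∈ P ∧ p.length = 4 ∧ (∀ v ∈ p, v ∉ L) ∧ p ∉ M := fun p =>
    Finset.mem_filter
  obtain ⟨F, hFU, T, hTU, hTF, hc, hFa, hTa⟩ := exists_middle_and_attached hG hP.toIsPacking
    (U := U) fun p hp => ⟨((hU p).1 hp).1, ((hU p).1 hp).2.1, ((hU p).1 hp).2.2.1⟩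
  have he : ∀ p, ∃ D, p ∈ P → p.length = 8 → (∀ v ∈ p, v ∉ L) →
      IsEightCode G p (hooked G P) (fourEnds P) D := by
    intro p
    by_cases h : p ∈ P ∧ p.length = 8 ∧ ∀ v ∈ p, v ∉ L
    · obtain ⟨D, hD⟩ := hP.exists_eightCode hG h.1 h.2.1 h.2.2
      exact ⟨D, fun _ _ _ => hD⟩
    · exact ⟨∅, fun h₁ h₂ h₃ => absurd ⟨h₁, h₂, h₃⟩ h⟩
  choose e he using he
  have h1 : CodeData G L P E M ∅ ∅ e False :=
    ⟨hP, hE, hmark, he, by simp, by simp, by simp, by simp, by simp⟩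
  have h2 : CodeData G L P E M F T e True :=
    ⟨hP, hE, hmark, he, fun p hp => (hU p).1 (hFU hp), fun p hp =>
      have h := (hU p).1 (hTU hp)
      ⟨h.1, h.2.1, h.2.2.1, h.2.2.2, hTF p hp⟩, hFa, hTa, fun _ _ => trivial⟩
  have c1 := h1.card_le hU hM hMc hEc
  have c2 := h2.card_le hU hM hMc hEc
  simp only [Finset.card_empty, if_true, if_false] at c1 c2
  -- With s paths on five vertices, `c1` settles the case |U| ≤ 4s. If |U| > 4s, then 7(|F| + |T|) ≥
  -- 7|U|/2 > |U| + 10s, and `c2` suffices.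
  by_cases hlt : 2 * (Finset.univ.filter fun x => x ∉ L).card ≤
      7 * (Finset.univ.filter fun x => x ∈ codeCompl G L P (pathCode L M ∅ ∅ e False) E).card
  · exact ⟨_, by simpa using h1.isIdentifyingCode hG, hlt⟩
  · exact ⟨Finset.univ.filter fun x => x ∈ codeCompl G L P (pathCode L M F T e True) E,
      by simpa using h2.isIdentifyingCode hG, by omega⟩

end GirthFive

/-! ### From girth and identifiability to `Setting`, and the theorem -/

namespace GirthFive
open SimpleGraph

theorem no_triangle_of_egirth {V : Type*} {G : SimpleGraph V} (h : 5 ≤ G.egirth) {a b c : V}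
    (hab : G.Adj a b) (hbc : G.Adj b c) : ¬ G.Adj a c := by
  intro hac
  have hcyc : (Walk.cons hab (Walk.cons hbc (Walk.cons hac.symm Walk.nil))).IsCycle := by
    simp [Walk.cons_isCycle_iff, hab.ne, hbc.ne, hac.ne, hac.ne', hab.ne']
  have := h.trans (egirth_le_length hcyc)
  simp only [Walk.length_cons, Walk.length_nil] at this
  exact absurd (by exact_mod_cast this : 5 ≤ 3) (by norm_num)

theorem no_square_of_egirth {V : Type*} {G : SimpleGraph V} (h : 5 ≤ G.egirth) {a b c d : V}
    (hab : G.Adj a b) (hbc : G.Adj b c) (hcd : G.Adj c d) (hda : G.Adj d a) : a = c ∨ b = d := by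
  by_contra! hne
  have hcyc : (Walk.cons hab (Walk.cons hbc (Walk.cons hcd (Walk.cons hda Walk.nil)))).IsCycle := by
    simp [Walk.cons_isCycle_iff, hab.ne, hbc.ne, hcd.ne, hda.ne, hda.ne', hab.ne',
      hne.1, hne.2, hne.1.symm]
  have := h.trans (egirth_le_length hcyc)
  simp only [Walk.length_cons, Walk.length_nil] at this
  exact absurd (by exact_mod_cast this : 5 ≤ 4) (by norm_num)

/-- Identifiability enters only in excluding components that are single edges: two adjacent leaves
are closed twins. -/
theorem setting_of_identifiable {V : Type*} [Fintype V] {G : SimpleGraph V} [DecidableRel G.Adj]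
    (hid : G.Identifiable) (hgirth : 5 ≤ G.egirth) (hiso : ∀ v : V, ¬ G.IsIsolated v) :
    Setting G G.leafSet := by
  have hleaf : ∀ v, v ∈ G.leafSet ↔ ∃! a, G.Adj v a := fun v =>
    degree_eq_one_iff_existsUnique_adj
  refine ⟨fun a b c h1 h2 => no_triangle_of_egirth hgirth h1 h2,
    fun a b c d h1 h2 h3 h4 => no_square_of_egirth hgirth h1 h2 h3 h4, ?_, fun v hv => ?_, ?_⟩
  · intro v hv
    have := hiso v
    unfold IsIsolated at this
    push Not at this
    obtain ⟨a, ha⟩ := this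
    rw [hleaf] at hv
    by_contra! h
    exact hv ⟨a, ha, fun b hb => by_contra fun hne => h a b (Ne.symm hne) ha hb⟩
  · obtain ⟨a, ha, h⟩ := (hleaf v).1 hv
    exact ⟨a, ha, h⟩
  · intro u v huv hu hv
    obtain ⟨a, -, ha⟩ := (hleaf u).1 hu
    obtain ⟨b, -, hb⟩ := (hleaf v).1 hv
    refine hid u v ⟨huv.ne, ?_⟩
    ext x
    simp only [closedNbhd, Set.mem_union, mem_neighborSet, Set.mem_singleton_iff]
    have hav := ha v huv
    have hbu := hb u huv.symm
    constructor
    · rintro (h | rfl)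
      · exact Or.inr ((ha x h).trans hav.symm)
      · exact Or.inl huv.symm
    · rintro (h | rfl)
      · exact Or.inr ((hb x h).trans hbu.symm)
      · exact Or.inl huv

end GirthFive

open GirthFive in
theorem mainTheorem2 {V : Type*} [Fintype V] (G : SimpleGraph V) [DecidableRel G.Adj]
    (hid : G.Identifiable) (hgirth : 5 ≤ G.egirth) (hiso : ∀ v : V, ¬ G.IsIsolated v) :
    (G.idNumber : ℚ) ≤ (5 * (Fintype.card V : ℚ) + 2 * (G.numLeaves : ℚ)) / 7 := by
  classical
  obtain ⟨D, hD, hc⟩ := (setting_of_identifiable hid hgirth hiso).exists_isIdentifyingCode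
  have h1 : G.idNumber ≤ Dᶜ.card := by
    refine Nat.sInf_le ⟨_, hD, ?_⟩
    rw [← Finset.coe_compl, Set.ncard_coe_finset]
  have h2 : D.card + Dᶜ.card = Fintype.card V := Finset.card_add_card_compl D
  have h3 : G.numLeaves + (Finset.univ.filter fun x => x ∉ G.leafSet).card = Fintype.card V := by
    have h : G.numLeaves = (Finset.univ.filter fun x => x ∈ G.leafSet).card := by
      unfold SimpleGraph.numLeaves
      rw [← Set.ncard_coe_finset]
      simp
    rw [h, ← Finset.card_univ]
    exact Finset.card_filter_add_card_filter_not _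
  have h4 : 7 * G.idNumber ≤ 5 * Fintype.card V + 2 * G.numLeaves := by omega
  rw [le_div_iff₀ (by norm_num)]
  have : (7 * G.idNumber : ℚ) ≤ 5 * Fintype.card V + 2 * G.numLeaves := by exact_mod_cast h4
  linarith
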